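/- **Conventions.** A *2-complex* is a connected CW complex of dimension at most $2$. An *immersion* of CW complexes is a continuous map which carries every open $n$-cell bijectively onto an open $n$-cell and is such that every point has a neighbourhood mapped homeomorphically onto its image. Let $X,P$ be sets. A complex $B_{X,P}$ is a CW complex with one $0$-cell, with $1$-cells indexed by $X$ and $2$-cells indexed by $P$, and no other cells, in which each $2$-cell $\rho\in P$ is attached along a specified closed edge walk, read once around the boundary circle from a specified base point $x_\rho$ of that circle; its label is the word $bl(\rho)\in (X\cup X^{-1})^*$ (if $bl(\rho)$ is empty, the attaching map is constant). A 2-complex $\mathcal K$ is *labeled* by an immersion $g:\mathcal K\to B_{X,P}$: each $n$-cell $c$ gets as its label the cell $x=g(c)$, and the characteristic map of $x$ lifts uniquely to a map $\psi_c$ of the closed disk into the closure of $c$ with $g\circ\psi_c$ the characteristic map of $x$. This directs the $1$-cells, and gives each $2$-cell $c$ with label $\rho$ the root $\alpha(c)=\psi_c(x_\rho)$. An immersion $f:\mathcal C\to\mathcal D$ between 2-complexes labeled by $g_{\mathcal C}$ and $g_{\mathcal D}$ over the same $B_{X,P}$ *respects the labeling* if $g_{\mathcal D}\circ f=g_{\mathcal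 C}$, that is, if the labeling of $\mathcal C$ is the one induced from that of $\mathcal D$ through $f$. Let $\Gamma_{\mathcal K}$ be the graph whose vertices are the $0$-cells of $\mathcal K$ and whose edges are the $1$-cells, in both directions and labeled over $X\cup X^{-1}$, together with, for each $2$-cell $c$, a loop $e_c$ at $\alpha(c)$ labeled by the label of $c$ in $P$, with $e_c^{-1}=e_c$. Let $\sim$ be the congruence on the free category on $\Gamma_{\mathcal K}$ generated by $p=pp^{-1}p$ for all paths $p$; $pp^{-1}qq^{-1}=qq^{-1}pp^{-1}$ for all paths $p,q$ with the same initial vertex; $e_c^2=e_c$ for all $2$-cells $c$; and $e_c=e_cq$ for all $2$-cells $c$ and all closed paths $q$ at $\alpha(c)$ whose label is $bl(\rho)$, where $\rho$ is the label of $c$. For a $0$-cell $v$, the loop monoid $L(\mathcal K,v)$ is the inverse monoid of $\sim$-classes of closed paths at $v$. The natural partial order of an inverse monoid is: $a\le b$ iff $a=eb$ for some idempotent $e$; an inverse submonoid is *closed* if it is upward closed in this order, and *full* if it contains all idempotents. **Theorem.** Let $\mathcal C,\mathcal D$ be 2-complexes labeled by immersions over the same complex $B_{X,P}$, let $f:\mathcal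 C\to\mathcal D$ be an immersion that respects the labeling, and let $v$ be any $0$-cell of $\mathcal C$. Then the homomorphism $L(\mathcal C,v)\to L(\mathcal D,f(v))$ induced by $f$ is injective, and, when $L(\mathcal C,v)$ is identified with its image, $f$ is a covering map if and only if $L(\mathcal C,v)$ is a full closed inverse submonoid of $L(\mathcal D,f(v))$, that is, a closed inverse submonoid that contains all idempotents of $L(\mathcal D,f(v))$. -/

import Mathlib

open Set Metric Topology CategoryTheory

universe u v w

noncomputable section

namespace TwoComplexes

/-! ### Cell complexes, immersions -/

/-- The `n`-cells of a space `K` that carries a CW structure. -/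
abbrev Cell (K : Type u) [TopologicalSpace K] [CWComplex (univ : Set K)] (n : ℕ) : Type u :=
  RelCWComplex.cell (univ : Set K) n

section Complexes

variable {K : Type u} [TopologicalSpace K] [CWComplex (univ : Set K)]
variable {L : Type v} [TopologicalSpace L] [CWComplex (univ : Set L)]

/-- The characteristic map `φ_c` of an `n`-cell. Mathlib takes as model of the closed `n`-disk
the closed unit ball of the maximum norm on `Fin n → ℝ`, that is, the cube `[-1,1]ⁿ`. -/
def charMap {n : ℕ} (c : Cell K n) : (Fin n → ℝ) → K := RelCWComplex.map n c

/-- The open `n`-cell (as a subset of the space) with index `c`. -/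
def openCell {n : ℕ} (c : Cell K n) : Set K := RelCWComplex.openCell n c

variable (K) in
/-- A *2-complex*: a connected CW complex of dimension at most two. -/
structure IsTwoComplex : Prop where
  connected : ConnectedSpace K
  dim_le_two : ∀ n, 2 < n → IsEmpty (Cell K n)

/-- `p` is a 0-cell. -/
def IsVertex (p : K) : Prop := ∃ c : Cell K 0, p ∈ openCell c

/-- An *immersion* of CW complexes: a continuous map that carries each open `n`-cell bijectively
onto an open `n`-cell and such that each point has a neighbourhood which is mapped
homeomorphically onto its image. -/
structure IsImmersion (f : K → L) : Prop where
  continuous : Continuous f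
  cells : ∀ (n : ℕ) (c : Cell K n), ∃ d : Cell L n, BijOn f (openCell c) (openCell d)
  locally_embedding : ∀ y : K, ∃ U ∈ 𝓝 y, IsEmbedding (U.domRestrict f)

/-- The cell `f(c)`. -/
def IsImmersion.cellMap {f : K → L} (hf : IsImmersion f) {n : ℕ} (c : Cell K n) : Cell L n :=
  (hf.cells n c).choose

theorem IsImmersion.image_openCell {f : K → L} (hf : IsImmersion f) {n : ℕ} (c : Cell K n) :
    f '' openCell c = openCell (hf.cellMap c) :=
  (hf.cells n c).choose_spec.image_eq

theorem IsImmersion.isVertex {f : K → L} (hf : IsImmersion f) {p : K} (hp : IsVertex p) :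
    IsVertex (f p) := by
  obtain ⟨c, hc⟩ := hp
  exact ⟨hf.cellMap c, hf.image_openCell c ▸ mem_image_of_mem f hc⟩

end Complexes

/-! ### The complexes `B_{X,P}` -/

section Bouquet

variable {B : Type w} [TopologicalSpace B] [CWComplex (univ : Set B)]

/-- The point at time `s ∈ [0,1]` on a directed edge: `(x, true)` is the 1-cell `x` traversed in
the direction of its characteristic map `[-1,1] → B`, and `(x, false)` is the inverse edge. -/
def edgePoint (a : Cell B 1 × Bool) (s : ℝ) : B :=
  charMap a.1 (fun _ => if a.2 then 2 * s - 1 else 1 - 2 * s)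

/-- The word `a` in the directed edges is the boundary walk of the 2-cell `ρ` read from the point
`x₀` of the boundary circle of the disk. If `a` is empty, the attaching map is constant, with value
a 0-cell. If `a` has length `n > 0`, then going once around the circle from `x₀` along a suitable
parametrization `θ : [0,n] → circle`, the attaching map traverses the `i`-th letter of `a` during
the time interval `[i,i+1]`. -/
structure IsBoundaryWalk (ρ : Cell B 2) (x₀ : Fin 2 → ℝ) (a : List (Cell B 1 × Bool)) : Prop where
  mem_sphere : x₀ ∈ sphere (0 : Fin 2 → ℝ) 1
  of_nil : a = [] → ∃ b : Cell B 0, ∀ z ∈ sphere (0 : Fin 2 → ℝ) 1, charMap ρ z ∈ openCell b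
  of_ne_nil : a ≠ [] → ∃ θ : ℝ → (Fin 2 → ℝ),
    ContinuousOn θ (Icc 0 (a.length : ℝ)) ∧
    InjOn θ (Ico 0 (a.length : ℝ)) ∧
    θ '' Icc 0 (a.length : ℝ) = sphere (0 : Fin 2 → ℝ) 1 ∧
    θ 0 = x₀ ∧ θ (a.length : ℝ) = x₀ ∧
    ∀ (i : Fin a.length), ∀ s ∈ Icc (0 : ℝ) 1,
      charMap ρ (θ ((i : ℕ) + s)) = edgePoint (a.get i) s

variable (B) in
/-- `B` is a complex `B_{X,P}`: it has one 0-cell, its 1-cells are the elements of `X`, its 2-cells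
are the elements of `P`, it has no further cells, and each 2-cell `ρ` has a specified base point
on the boundary of the disk and a specified boundary walk `bl ρ`, a word over `X ∪ X⁻¹`. -/
structure BouquetComplex where
  existsUnique_vertex : ∃! _b : Cell B 0, True
  dim_le_two : ∀ n, 2 < n → IsEmpty (Cell B n)
  root : Cell B 2 → (Fin 2 → ℝ)
  bl : Cell B 2 → List (Cell B 1 × Bool)
  isBoundaryWalk : ∀ ρ, IsBoundaryWalk ρ (root ρ) (bl ρ)

end Bouquet

/-! ### The labeling induced by an immersion `g : K → B_{X,P}` and the graph `Γ_K` -/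

section Labeling

variable {B : Type w} [TopologicalSpace B] [CWComplex (univ : Set B)]
variable {K : Type u} [TopologicalSpace K] [CWComplex (univ : Set K)]

/-- `ψ`, defined on the closed disk, is the characteristic map of the cell `c` of `K` that lies
over the characteristic map of the cell `x` of `B`: it carries the open disk onto the open cell `c`
and satisfies `g ∘ ψ = φ_x`. In particular `g` maps the cell `c` to the cell `x`, so `c` has
label `x`. -/
structure IsCellLift (g : K → B) {n : ℕ} (c : Cell K n) (x : Cell B n)
    (ψ : (Fin n → ℝ) → K) : Prop where
  continuousOn : ContinuousOn ψ (closedBall 0 1)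
  image_ball : ψ '' ball 0 1 = openCell c
  comp_eq : ∀ z ∈ closedBall (0 : Fin n → ℝ) 1, g (ψ z) = charMap x z

/-- The 1-cell `e`, in the direction in which its label is `x ∈ X`, runs from `p` to `q`. -/
def IsEdge (g : K → B) (e : Cell K 1) (x : Cell B 1) (p q : K) : Prop :=
  ∃ ψ, IsCellLift g e x ψ ∧ ψ (fun _ => -1) = p ∧ ψ (fun _ => 1) = q

/-- The 2-cell `c` has label `ρ ∈ P`, and `p` is its root `α(c)`, the point that corresponds to
the base point `x₀` on the boundary of the disk. -/
def IsFace (g : K → B) (c : Cell K 2) (ρ : Cell B 2) (x₀ : Fin 2 → ℝ) (p : K) : Prop :=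
  ∃ ψ, IsCellLift g c ρ ψ ∧ ψ x₀ = p

/-- The vertices of the graph `Γ_K` of the complex `K` labeled by `g : K → B_{X,P}`. -/
@[ext]
structure Vertex (W : BouquetComplex B) (g : K → B) where
  pt : K
  isVertex : IsVertex pt

variable (W : BouquetComplex B) (g : K → B)

/-- The directed edges of `Γ_K`: each 1-cell in its two directions, and a loop `e_c` at the root of
each 2-cell `c`. -/
inductive Arrow : Vertex W g → Vertex W g → Type (max u w)
  | pos {p q : Vertex W g} (e : Cell K 1) (x : Cell B 1) (h : IsEdge g e x p.pt q.pt) : Arrow p q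
  | neg {p q : Vertex W g} (e : Cell K 1) (x : Cell B 1) (h : IsEdge g e x q.pt p.pt) : Arrow p q
  | face {p : Vertex W g} (c : Cell K 2) (ρ : Cell B 2) (h : IsFace g c ρ (W.root ρ) p.pt) :
      Arrow p p

instance : Quiver.{max u w} (Vertex W g) := ⟨Arrow W g⟩

variable {W g}

/-- The label of an edge of `Γ_K`, an element of `(X ∪ X⁻¹) ∪ P`. -/
def Arrow.label : ∀ {p q : Vertex W g}, Arrow W g p q → (Cell B 1 × Bool) ⊕ Cell B 2
  | _, _, .pos _ x _ => Sum.inl (x, true)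
  | _, _, .neg _ x _ => Sum.inl (x, false)
  | _, _, .face _ ρ _ => Sum.inr ρ

/-- The inverse edge; the loops `e_c` are their own inverses. -/
def Arrow.inv : ∀ {p q : Vertex W g}, Arrow W g p q → Arrow W g q p
  | _, _, .pos e x h => .neg e x h
  | _, _, .neg e x h => .pos e x h
  | _, _, .face c ρ h => .face c ρ h

instance : Quiver.HasReverse (Vertex W g) := ⟨fun a => Arrow.inv a⟩

/-- The word read along a path of `Γ_K`. -/
def pathLabel {p : Vertex W g} :
    ∀ {q : Vertex W g}, Quiver.Path p q → List ((Cell B 1 × Bool) ⊕ Cell B 2)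
  | _, .nil => []
  | _, .cons a e => pathLabel a ++ [Arrow.label e]

/-- The relations that generate the congruence `∼` on the free category on `Γ_K`: those of the
free inverse category on `Γ_K`, and `e = e²`, `e = e q` for each loop `e = e_c` and each path `q`
coterminal with `e` such that `ℓ(q) = bl(ℓ(e))`. Paths are composed from left to right. -/
inductive PathRel : ∀ {p q : Vertex W g}, Quiver.Path p q → Quiver.Path p q → Prop
  | regular {p q : Vertex W g} (a : Quiver.Path p q) :
      PathRel a ((a.comp a.reverse).comp a)
  | commute {p q r : Vertex W g} (a : Quiver.Path p q) (b : Quiver.Path p r) :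
      PathRel ((a.comp a.reverse).comp (b.comp b.reverse))
        ((b.comp b.reverse).comp (a.comp a.reverse))
  | idempotent {p : Vertex W g} (e : p ⟶ p) (ρ : Cell B 2) (he : Arrow.label e = Sum.inr ρ) :
      PathRel e.toPath (e.toPath.comp e.toPath)
  | boundary {p : Vertex W g} (e : p ⟶ p) (ρ : Cell B 2) (he : Arrow.label e = Sum.inr ρ)
      (b : Quiver.Path p p) (hb : pathLabel b = (W.bl ρ).map Sum.inl) :
      PathRel e.toPath (e.toPath.comp b)

variable (W g)

/-- The generating relations, on the free category on `Γ_K`. -/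
def pathHomRel : HomRel (Paths (Vertex W g)) := fun p q a b =>
  PathRel (p := (p : Vertex W g)) (q := (q : Vertex W g)) a b

/-- The inverse category `IC(K)` of the labeled complex `K`: the free category on `Γ_K` modulo the
congruence generated by the relations above. -/
abbrev InverseCategory : Type u := CategoryTheory.Quotient (pathHomRel W g)

variable {W g}

/-- The loop monoid `L(K,v)`: the endomorphisms of `v` in `IC(K)`. (The opposite is taken since
multiplication in `End` is composition from right to left.) -/
abbrev LoopMonoid (v : Vertex W g) : Type (max u w) :=
  (End (X := (CategoryTheory.Quotient.functor (pathHomRel W g)).obj v))ᵐᵒᵖ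

end Labeling

/-! ### The map of loop monoids induced by a label-respecting immersion -/

section Induced

variable {B : Type w} [TopologicalSpace B] [CWComplex (univ : Set B)]
variable {K : Type u} [TopologicalSpace K] [CWComplex (univ : Set K)]
variable {L : Type v} [TopologicalSpace L] [CWComplex (univ : Set L)]
variable {W : BouquetComplex B} {gK : K → B} {gL : L → B} {f : K → L}

theorem IsCellLift.map (hf : IsImmersion f) (hlab : gL ∘ f = gK) {n : ℕ} {c : Cell K n}
    {x : Cell B n} {ψ : (Fin n → ℝ) → K} (h : IsCellLift gK c x ψ) :
    IsCellLift gL (hf.cellMap c) x (f ∘ ψ) where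
  continuousOn := hf.continuous.comp_continuousOn h.continuousOn
  image_ball := by rw [image_comp, h.image_ball, hf.image_openCell]
  comp_eq z hz := by rw [← h.comp_eq z hz, ← hlab]; rfl

theorem IsEdge.map (hf : IsImmersion f) (hlab : gL ∘ f = gK) {e : Cell K 1} {x : Cell B 1}
    {p q : K} (h : IsEdge gK e x p q) : IsEdge gL (hf.cellMap e) x (f p) (f q) := by
  obtain ⟨ψ, h, rfl, rfl⟩ := h
  exact ⟨f ∘ ψ, h.map hf hlab, rfl, rfl⟩

theorem IsFace.map (hf : IsImmersion f) (hlab : gL ∘ f = gK) {c : Cell K 2} {ρ : Cell B 2}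
    {x₀ : Fin 2 → ℝ} {p : K} (h : IsFace gK c ρ x₀ p) :
    IsFace gL (hf.cellMap c) ρ x₀ (f p) := by
  obtain ⟨ψ, h, rfl⟩ := h
  exact ⟨f ∘ ψ, h.map hf hlab, rfl⟩

/-- The vertex `f(v)`. -/
def Vertex.map (hf : IsImmersion f) (p : Vertex W gK) : Vertex W gL :=
  ⟨f p.pt, hf.isVertex p.isVertex⟩

/-- The edge `f(a)` of `Γ_L`, for an edge `a` of `Γ_K`. -/
def Arrow.map (hf : IsImmersion f) (hlab : gL ∘ f = gK) : ∀ {p q : Vertex W gK},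
    Arrow W gK p q → Arrow W gL (p.map hf) (q.map hf)
  | _, _, .pos e x h => .pos (hf.cellMap e) x (h.map hf hlab)
  | _, _, .neg e x h => .neg (hf.cellMap e) x (h.map hf hlab)
  | _, _, .face c ρ h => .face (hf.cellMap c) ρ (h.map hf hlab)

/-- The map of graphs `Γ_K → Γ_L` induced by `f`. -/
def graphMap (hf : IsImmersion f) (hlab : gL ∘ f = gK) : Vertex W gK ⥤q Vertex W gL where
  obj p := p.map hf
  map a := Arrow.map hf hlab a

theorem Arrow.map_inv (hf : IsImmersion f) (hlab : gL ∘ f = gK) {p q : Vertex W gK}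
    (a : Arrow W gK p q) : Arrow.map hf hlab a.inv = (Arrow.map hf hlab a).inv := by
  cases a <;> rfl

theorem label_map (hf : IsImmersion f) (hlab : gL ∘ f = gK) {p q : Vertex W gK}
    (a : Arrow W gK p q) : (Arrow.map hf hlab a).label = a.label := by
  cases a <;> rfl

theorem pathLabel_map (hf : IsImmersion f) (hlab : gL ∘ f = gK) {p q : Vertex W gK}
    (a : Quiver.Path p q) : pathLabel ((graphMap hf hlab).mapPath a) = pathLabel a := by
  induction a with
  | nil => rfl
  | cons a e ih =>
    simp only [Prefunctor.mapPath_cons, pathLabel, ih]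
    exact congrArg (fun l => pathLabel a ++ [l]) (label_map hf hlab e)

theorem mapPath_reverse (hf : IsImmersion f) (hlab : gL ∘ f = gK) {p q : Vertex W gK}
    (a : Quiver.Path p q) :
    (graphMap hf hlab).mapPath a.reverse = ((graphMap hf hlab).mapPath a).reverse := by
  induction a with
  | nil => rfl
  | cons a e ih =>
    simp only [Quiver.Path.reverse, Prefunctor.mapPath_comp, Prefunctor.mapPath_cons, ih,
      Prefunctor.mapPath_toPath]
    have : (graphMap hf hlab).map (Quiver.reverse e) =
        Quiver.reverse ((graphMap hf hlab).map e) := Arrow.map_inv hf hlab e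
    rw [this]

theorem PathRel.map (hf : IsImmersion f) (hlab : gL ∘ f = gK) {p q : Vertex W gK}
    {a b : Quiver.Path p q} (h : PathRel a b) :
    PathRel ((graphMap hf hlab).mapPath a) ((graphMap hf hlab).mapPath b) := by
  cases h with
  | regular a =>
    simp only [Prefunctor.mapPath_comp, mapPath_reverse]
    exact .regular _
  | commute a b =>
    simp only [Prefunctor.mapPath_comp, mapPath_reverse]
    exact .commute _ _
  | idempotent e ρ he =>
    simp only [Prefunctor.mapPath_comp, Prefunctor.mapPath_toPath]
    exact .idempotent _ ρ ((label_map hf hlab e).trans he)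
  | boundary e ρ he b hb =>
    simp only [Prefunctor.mapPath_comp, Prefunctor.mapPath_toPath]
    exact .boundary _ ρ ((label_map hf hlab e).trans he) _ ((pathLabel_map hf hlab b).trans hb)

/-- The functor induced by `f` on the free categories on `Γ_K` and `Γ_L`. -/
def pathFunctor (hf : IsImmersion f) (hlab : gL ∘ f = gK) :
    Paths (Vertex W gK) ⥤ Paths (Vertex W gL) where
  obj p := (graphMap hf hlab).obj p
  map a := (graphMap hf hlab).mapPath a
  map_id _ := rfl
  map_comp a b := Prefunctor.mapPath_comp _ a b

/-- The functor `IC(K) → IC(L)` induced by `f`. -/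
def inducedFunctor (hf : IsImmersion f) (hlab : gL ∘ f = gK) :
    InverseCategory W gK ⥤ InverseCategory W gL :=
  CategoryTheory.Quotient.lift (pathHomRel W gK)
    (pathFunctor hf hlab ⋙ CategoryTheory.Quotient.functor (pathHomRel W gL))
    (fun _ _ _ _ h => CategoryTheory.Quotient.sound (pathHomRel W gL) (PathRel.map hf hlab h))

/-- The homomorphism `L(K,v) → L(L,f(v))` induced by `f`: the class of a closed path is sent to the
class of its image. -/
def loopMap (hf : IsImmersion f) (hlab : gL ∘ f = gK) (p : Vertex W gK) :
    LoopMonoid p →* LoopMonoid (p.map hf : Vertex W gL) :=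
  MonoidHom.op ((inducedFunctor hf hlab).mapEnd
    ((CategoryTheory.Quotient.functor (pathHomRel W gK)).obj p))

end Induced

/-! ### Inverse monoids -/

section InverseMonoids

variable {M : Type u} [Monoid M]

/-- `b` is an inverse of `a` in the sense of inverse monoids. -/
def IsInverseOf (a b : M) : Prop := a * b * a = a ∧ b * a * b = b

/-- The natural partial order `a ≤ b` of an inverse monoid: `a = e b` for some idempotent `e`. -/
def NaturalLE (a b : M) : Prop := ∃ e : M, IsIdempotentElem e ∧ a = e * b

/-- `H` is a full closed inverse submonoid of the inverse monoid `M`. -/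
structure IsFullClosedInverseSubmonoid (H : Submonoid M) : Prop where
  inverse : ∀ a ∈ H, ∀ b, IsInverseOf a b → b ∈ H
  closed : ∀ a ∈ H, ∀ b, NaturalLE a b → b ∈ H
  full : ∀ e : M, IsIdempotentElem e → e ∈ H

end InverseMonoids

end TwoComplexes

end

set_option linter.unusedSectionVars false

namespace TwoComplexes

/-! ### Lifting characteristic maps through an immersion -/

section Lifts

/-! Everything rests on two facts about a complex labeled by an immersion. The first is topological:
the characteristic map of a cell of `B_{X,P}` lifts to every cell over it
(`IsImmersion.exists_isCellLift`), and two lifts that agree at one point agree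
(`IsImmersion.eqOn_of_comp_eqOn`). So the labeled graph is deterministic: a path is determined by
its initial vertex and its label (`path_eq_of_label_eq`).

The second is combinatorial. A generating relation of the loop monoid can be applied, in either
direction, to any path of another labeled complex that carries the label of one side, without moving
the endpoints (`PathRel.lift_left`, `PathRel.lift_right`). Hence an equality of classes in `D` pulls
back to `C` along labels (`exists_path_of_pathClass_eq`). With determinism this gives injectivity,
and it shows that the image of `L(C,v)` consists of the classes of closed paths at `f(v)` whose
label is also read on a closed path at `v` (`loopClass_mem_mrange`).

Topology and algebra meet in star surjectivity: every edge or face loop at `f(p)` lifts to `p`. A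
covering has it because disks are simply connected, and it makes the image full and closed, since
the closed paths required can be cut out of pulled-back equations. Conversely, let `a` be a path
from `v` to `q` and `e` an edge at `f(q)`. The class of `f(a) e e⁻¹ f(a)⁻¹` is idempotent; if it
lies in the image, its closed lift begins with `a` and then passes along a lift of `e` at `q`
(`isStarSurjective_of_full`). Connectedness of the graph supplies `a`.

To return from star surjectivity to a covering, 2-cells are first lifted from arbitrary boundary
points by moving along the boundary walk (`IsStarSurjective.exists_face_lift`). An evenly covered
neighbourhood is then built from an open cell, whose sheets are the open cells over it, by adding
radial collars dimension by dimension (`IsSheeting.thicken`); cell lifts make the collars of the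
sheets surjective, and make `f` open (`HasCellLifts.isOpenMap`). -/

theorem eq_of_mapClusterPt_of_tendsto {Y : Type u} {B : Type w} {A : Type*} [TopologicalSpace Y]
    [TopologicalSpace B] [T2Space B] {g : Y → B} {l : Filter A} {h : A → Y} {b : B} {y : Y}
    (hg : ContinuousAt g y) (hy : MapClusterPt y l h) (hl : Filter.Tendsto (g ∘ h) l (𝓝 b)) :
    g y = b :=
  have h1 : MapClusterPt (g y) l (g ∘ h) := hy.continuousAt_comp hg
  have h2 : (𝓝 (g y) ⊓ 𝓝 b).NeBot := Filter.NeBot.mono h1 (inf_le_inf_left _ hl)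
  eq_of_nhds_neBot h2

/-- Over a Hausdorff base, a lift along a locally injective map with compact source converges as
soon as its projection does, provided that the filter has a basis of sets with connected lifts. -/
theorem exists_tendsto_of_tendsto_comp {Y : Type u} {B : Type w} {A : Type*} [TopologicalSpace Y]
    [CompactSpace Y] [T2Space Y] [TopologicalSpace B] [T2Space B] {g : Y → B} (hg : Continuous g)
    (inj : IsLocallyInjective g) {l : Filter A} [l.NeBot] {h : A → Y} {b : B}
    (basis : ∀ s ∈ l, ∃ t ∈ l, t ⊆ s ∧ IsPreconnected (h '' t))
    (hl : Filter.Tendsto (g ∘ h) l (𝓝 b)) : ∃ y, Filter.Tendsto h l (𝓝 y) := by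
  obtain ⟨y, hy⟩ := exists_clusterPt_of_compactSpace (Filter.map h l)
  replace hy : MapClusterPt y l h := hy
  have hgy : g y = b := eq_of_mapClusterPt_of_tendsto hg.continuousAt hy hl
  refine ⟨y, fun V hV => ?_⟩
  obtain ⟨N, hN, hyN, hinj⟩ := inj y
  obtain ⟨C, hC, hCcl, hCN⟩ :=
    exists_mem_nhds_isClosed_subset (Filter.inter_mem (hN.mem_nhds hyN) hV)
  set U := interior C
  have hyU : y ∈ U := mem_interior_iff_mem_nhds.2 hC
  have hcl : closure U ⊆ N ∩ V := (closure_minimal interior_subset hCcl).trans hCN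
  -- `g` is injective on a set containing the closure of `U`, so `y` is the only point there over
  -- `b`, and `y` is interior to `U`.
  have hfr : b ∉ g '' frontier U := by
    rintro ⟨z, hz, hzb⟩
    have : z = y := hinj (hcl (frontier_subset_closure hz)).1 hyN (hzb.trans hgy.symm)
    subst this
    rw [isOpen_interior.frontier_eq] at hz
    exact hz.2 hyU
  have hclosed : IsClosed (g '' frontier U) := (isClosed_frontier.isCompact.image hg).isClosed
  -- Near the limit the lift avoids the frontier of `U`, so a connected piece of it lies inside `U`
  -- or outside its closure; the cluster point decides for the inside.
  obtain ⟨t, ht, hts, hpre⟩ := basis _ (hl (hclosed.isOpen_compl.mem_nhds hfr))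
  have hne : (h '' t ∩ U).Nonempty := by
    have := hy.frequently (isOpen_interior.mem_nhds hyU)
    obtain ⟨a, ha, hat⟩ := (Filter.Frequently.and_eventually this ht).exists
    exact ⟨h a, mem_image_of_mem h hat, ha⟩
  have hsub : h '' t ⊆ U := by
    refine hpre.subset_left_of_subset_union isOpen_interior (isClosed_closure (s := U)).isOpen_compl
      (disjoint_compl_right.mono_left subset_closure) ?_ hne
    rintro _ ⟨a, ha, rfl⟩
    by_contra hcon
    rw [mem_union, not_or] at hcon
    refine hts ha ⟨h a, ?_, rfl⟩
    rw [isOpen_interior.frontier_eq]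
    exact ⟨not_not.1 hcon.2, hcon.1⟩
  rw [Filter.mem_map]
  exact Filter.mem_of_superset ht fun a ha =>
    (hcl (subset_closure (hsub (mem_image_of_mem h ha)))).2

variable {K : Type u} [TopologicalSpace K] [T2Space K] [CWComplex (univ : Set K)]
variable {B : Type w} [TopologicalSpace B] [T2Space B] [CWComplex (univ : Set B)]

theorem exists_mem_openCell (y : K) : ∃ (n : ℕ) (c : Cell K n), y ∈ openCell c := by
  have h : y ∈ ⋃ (n : ℕ) (j : Cell K n), RelCWComplex.openCell n j := by
    rw [CWComplex.iUnion_openCell_eq_complex]; trivial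
  rwa [mem_iUnion₂] at h

theorem sigma_eq_of_mem_openCell {y : K} {n m : ℕ} {c : Cell K n} {d : Cell K m}
    (hc : y ∈ openCell c) (hd : y ∈ openCell d) : (⟨n, c⟩ : Σ n, Cell K n) = ⟨m, d⟩ :=
  CWComplex.eq_of_not_disjoint_openCell (not_disjoint_iff.2 ⟨y, hc, hd⟩)

theorem dim_eq_of_mem_openCell {y : K} {n m : ℕ} {c : Cell K n} {d : Cell K m}
    (hc : y ∈ openCell c) (hd : y ∈ openCell d) : n = m :=
  congrArg Sigma.fst (sigma_eq_of_mem_openCell hc hd)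

theorem cell_eq_of_mem_openCell {y : K} {n : ℕ} {c d : Cell K n}
    (hc : y ∈ openCell c) (hd : y ∈ openCell d) : c = d := by
  have := sigma_eq_of_mem_openCell hc hd
  simpa using this

theorem charMap_mem_openCell {n : ℕ} (c : Cell K n) {z : Fin n → ℝ} (hz : z ∈ ball 0 1) :
    charMap c z ∈ openCell c := mem_image_of_mem _ hz

theorem charMap_injOn {n : ℕ} (c : Cell K n) : InjOn (charMap c) (ball 0 1) := by
  have := (RelCWComplex.map n c).injOn
  rwa [RelCWComplex.source_eq] at this

theorem charMap_continuousOn {n : ℕ} (c : Cell K n) : ContinuousOn (charMap c) (closedBall 0 1) :=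
  RelCWComplex.continuousOn n c

variable (K) in
/-- The union of the cells of dimension less than `n`. -/
def skel (n : ℕ) : Set K := (RelCWComplex.skeletonLT (univ : Set K) n : Set K)

theorem mem_skel {n : ℕ} {y : K} : y ∈ skel K n ↔ ∃ m < n, ∃ c : Cell K m, y ∈ openCell c := by
  unfold skel
  rw [SetLike.mem_coe, CWComplex.mem_skeletonLT_iff]
  simp [openCell]

theorem mem_skel_iff_of_mem_openCell {n m : ℕ} {y : K} {c : Cell K m} (hc : y ∈ openCell c) :
    y ∈ skel K n ↔ m < n := by
  rw [mem_skel]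
  constructor
  · rintro ⟨k, hk, d, hd⟩
    rwa [dim_eq_of_mem_openCell hc hd]
  · exact fun h => ⟨m, h, c, hc⟩

theorem skel_mono {n m : ℕ} (h : n ≤ m) : skel K n ⊆ skel K m := fun y hy => by
  obtain ⟨k, hk, c, hc⟩ := mem_skel.1 hy
  exact mem_skel.2 ⟨k, hk.trans_le h, c, hc⟩

theorem charMap_mem_skel {n : ℕ} (c : Cell K n) {z : Fin n → ℝ} (hz : z ∈ sphere 0 1) :
    charMap c z ∈ skel K n :=
  RelCWComplex.cellFrontier_subset_skeletonLT n c (mem_image_of_mem _ hz)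

theorem isVertex_iff_mem_skel {y : K} : IsVertex y ↔ y ∈ skel K 1 := by
  rw [mem_skel]
  constructor
  · rintro ⟨c, hc⟩
    exact ⟨0, one_pos, c, hc⟩
  · rintro ⟨m, hm, c, hc⟩
    obtain rfl : m = 0 := by omega
    exact ⟨c, hc⟩

namespace IsImmersion

variable {g : K → B} (hg : IsImmersion g)
include hg

theorem isLocallyInjective : IsLocallyInjective g := by
  rw [isLocallyInjective_iff_nhds]
  intro y
  obtain ⟨U, hU, hemb⟩ := hg.locally_embedding y
  exact ⟨U, hU, injOn_iff_injective.2 hemb.injective⟩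

theorem bijOn {n : ℕ} (c : Cell K n) : BijOn g (openCell c) (openCell (hg.cellMap c)) :=
  (hg.cells n c).choose_spec

theorem map_mem_openCell {n : ℕ} {c : Cell K n} {y : K} (hy : y ∈ openCell c) :
    g y ∈ openCell (hg.cellMap c) := (hg.bijOn c).mapsTo hy

theorem exists_mem_openCell {n : ℕ} {d : Cell B n} {y : K} (hy : g y ∈ openCell d) :
    ∃ c : Cell K n, y ∈ openCell c ∧ hg.cellMap c = d := by
  obtain ⟨m, c, hc⟩ := TwoComplexes.exists_mem_openCell y
  obtain rfl := dim_eq_of_mem_openCell (hg.map_mem_openCell hc) hy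
  exact ⟨c, hc, cell_eq_of_mem_openCell (hg.map_mem_openCell hc) hy⟩

/-- Open cells partition a complex and `g` preserves their dimension, so skeleta are reflected as
well as preserved. -/
theorem map_mem_skel_iff {n : ℕ} {y : K} : g y ∈ skel B n ↔ y ∈ skel K n := by
  obtain ⟨m, c, hc⟩ := TwoComplexes.exists_mem_openCell y
  rw [mem_skel_iff_of_mem_openCell hc, mem_skel_iff_of_mem_openCell (hg.map_mem_openCell hc)]

theorem isVertex_iff {y : K} : IsVertex (g y) ↔ IsVertex y := by
  rw [isVertex_iff_mem_skel, isVertex_iff_mem_skel, hg.map_mem_skel_iff]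

/-- Uniqueness of lifts through an immersion. -/
theorem eqOn_of_comp_eqOn {A : Type*} [TopologicalSpace A] {s : Set A}
    (hs : IsPreconnected s) {φ ψ : A → K} (hφ : ContinuousOn φ s) (hψ : ContinuousOn ψ s)
    (he : ∀ a ∈ s, g (φ a) = g (ψ a)) {a : A} (ha : a ∈ s) (h : φ a = ψ a) : EqOn φ ψ s :=
  (T2Space.isSeparatedMap g).eqOn_of_comp_eqOn hg.isLocallyInjective hs hφ hψ he ha h

/-- The characteristic map of `g(c)` lifts to a characteristic map of `c`. -/
theorem exists_isCellLift {n : ℕ} (c : Cell K n) :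
    ∃ ψ, IsCellLift g c (hg.cellMap c) ψ := by
  set d := hg.cellMap c
  have hcomp : IsCompact (RelCWComplex.closedCell n c : Set K) := RelCWComplex.isCompact_closedCell
  have hsub : openCell c ⊆ (RelCWComplex.closedCell n c : Set K) :=
    RelCWComplex.openCell_subset_closedCell n c
  have : CompactSpace (RelCWComplex.closedCell n c : Set K) := isCompact_iff_compactSpace.1 hcomp
  set Y := (RelCWComplex.closedCell n c : Set K)
  -- A frontier point lies in a cell of smaller dimension and so cannot map into an open `n`-cell.
  have hcell : ∀ y ∈ Y, g y ∈ openCell d → y ∈ openCell c := by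
    intro y hy hgy
    obtain ⟨c', hc', -⟩ := hg.exists_mem_openCell hgy
    rw [show Y = _ from (RelCWComplex.cellFrontier_union_openCell_eq_closedCell n c).symm] at hy
    rcases hy with hy | hy
    · have h1 : y ∈ skel K n := RelCWComplex.cellFrontier_subset_skeletonLT n c hy
      exact absurd ((mem_skel_iff_of_mem_openCell hc').1 h1) (lt_irrefl n)
    · exact hy
  have hex : ∀ z : Fin n → ℝ, ∃ y : Y, z ∈ ball (0 : Fin n → ℝ) 1 →
      y.1 ∈ openCell c ∧ g y = charMap d z := by
    intro z
    by_cases hz : z ∈ ball (0 : Fin n → ℝ) 1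
    · obtain ⟨y, hy, hyz⟩ := (hg.bijOn c).surjOn (charMap_mem_openCell d hz)
      exact ⟨⟨y, hsub hy⟩, fun _ => ⟨hy, hyz⟩⟩
    -- Outside the open disk the value is irrelevant; the centre of the cell serves as default.
    · exact ⟨⟨charMap c 0, hsub (charMap_mem_openCell c (by simp))⟩, fun h => absurd h hz⟩
  choose ψ₀ hψ₀ using hex
  have hcont : ContinuousOn ψ₀ (ball 0 1) := by
    intro z hz
    -- In the compact closed cell it suffices that cluster points are unique: each lies over
    -- `charMap d z`, hence in the open cell, where `g` is injective.
    refine isCompact_univ.tendsto_nhds_of_unique_mapClusterPt (by simp) fun y _ hy => ?_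
    have h2 : Filter.Tendsto (fun z => g (ψ₀ z)) (𝓝[ball 0 1] z) (𝓝 (charMap d z)) := by
      refine Filter.Tendsto.congr' ?_
        ((charMap_continuousOn d).mono ball_subset_closedBall z hz)
      filter_upwards [self_mem_nhdsWithin] with w hw using (hψ₀ w hw).2.symm
    have h3 : g y = charMap d z := eq_of_mapClusterPt_of_tendsto (g := fun y : Y => g y)
      (hg.continuous.comp continuous_subtype_val).continuousAt hy h2
    have h4 : y.1 ∈ openCell c := hcell y y.2 (h3 ▸ charMap_mem_openCell d hz)
    exact Subtype.ext ((hg.bijOn c).injOn h4 (hψ₀ z hz).1 (h3.trans (hψ₀ z hz).2.symm))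
  have hcl : closedBall (0 : Fin n → ℝ) 1 = closure (ball 0 1) := (closure_ball 0 one_ne_zero).symm
  -- Boundary values exist by `exists_tendsto_of_tendsto_comp`: the traces of small balls on the
  -- open disk are convex, so their lifts are connected.
  have hlim : ∀ z ∈ closedBall (0 : Fin n → ℝ) 1,
      ∃ y, Filter.Tendsto ψ₀ (𝓝[ball 0 1] z) (𝓝 y) := by
    intro z hz
    have : (𝓝[ball (0 : Fin n → ℝ) 1] z).NeBot := mem_closure_iff_nhdsWithin_neBot.1 (hcl ▸ hz)
    refine exists_tendsto_of_tendsto_comp (g := fun y : Y => g y) (b := charMap d z)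
      (hg.continuous.comp continuous_subtype_val)
      (hg.isLocallyInjective.comp_right continuous_subtype_val Subtype.val_injective) ?_ ?_
    · intro s hs
      obtain ⟨ε, hε, hεs⟩ := Metric.mem_nhdsWithin_iff.1 hs
      refine ⟨ball z ε ∩ ball 0 1,
        Filter.inter_mem (mem_nhdsWithin_of_mem_nhds (ball_mem_nhds z hε)) self_mem_nhdsWithin, hεs, ?_⟩
      exact ((convex_ball z ε).inter (convex_ball 0 1)).isPreconnected.image _
        (hcont.mono inter_subset_right)
    · refine Filter.Tendsto.congr' ?_ (((charMap_continuousOn d) z hz).mono_left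
        (nhdsWithin_mono z ball_subset_closedBall))
      filter_upwards [self_mem_nhdsWithin] with w hw using (hψ₀ w hw).2.symm
  set ψ := extendFrom (ball (0 : Fin n → ℝ) 1) ψ₀
  have hψc : ContinuousOn ψ (closedBall 0 1) := continuousOn_extendFrom hcl.le hlim
  have hψe : ∀ z ∈ ball (0 : Fin n → ℝ) 1, ψ z = ψ₀ z := fun z hz =>
    extendFrom_eq (subset_closure hz) (hcont z hz)
  refine ⟨fun z => ψ z, continuous_subtype_val.comp_continuousOn hψc, ?_, ?_⟩
  · apply Subset.antisymm
    · rintro _ ⟨z, hz, rfl⟩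
      simp only [hψe z hz]
      exact (hψ₀ z hz).1
    · intro y hy
      obtain ⟨z, hz, hzy⟩ := hg.map_mem_openCell hy
      refine ⟨z, hz, ?_⟩
      simp only [hψe z hz]
      exact (hg.bijOn c).injOn (hψ₀ z hz).1 hy ((hψ₀ z hz).2.trans hzy)
  · exact EqOn.of_subset_closure (fun z hz => by simp only [hψe z hz]; exact (hψ₀ z hz).2)
      ((hg.continuous.comp continuous_subtype_val).comp_continuousOn hψc)
      (charMap_continuousOn d) ball_subset_closedBall hcl.le

end IsImmersion

end Lifts

/-! ### Uniqueness of lifted characteristic maps, and edges -/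

section CellLifts

variable {K : Type u} [TopologicalSpace K] [T2Space K] [CWComplex (univ : Set K)]
variable {B : Type w} [TopologicalSpace B] [T2Space B] [CWComplex (univ : Set B)]

theorem isPreconnected_closedBall {n : ℕ} : _root_.IsPreconnected (closedBall (0 : Fin n → ℝ) 1) :=
  (convex_closedBall 0 1).isPreconnected

theorem closedBall_eq_closure_ball {n : ℕ} :
    closedBall (0 : Fin n → ℝ) 1 = closure (ball 0 1) := (closure_ball 0 one_ne_zero).symm

/-- The point of the model of the 1-cell that is reached at time `s` on a directed edge. -/
def edgeParam (b : Bool) (s : ℝ) : Fin 1 → ℝ := fun _ => if b then 2 * s - 1 else 1 - 2 * s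

theorem continuous_edgeParam (b : Bool) : Continuous (edgeParam b) := by
  refine continuous_pi fun _ => ?_
  cases b <;> simp only [edgeParam, Bool.false_eq_true, if_false, if_true] <;> fun_prop

theorem edgeParam_mem_closedBall (b : Bool) {s : ℝ} (hs : s ∈ Icc (0 : ℝ) 1) :
    edgeParam b s ∈ closedBall (0 : Fin 1 → ℝ) 1 := by
  rw [mem_closedBall_zero_iff, pi_norm_le_iff_of_nonneg zero_le_one]
  intro i
  rw [Real.norm_eq_abs, abs_le]
  obtain ⟨h1, h2⟩ := hs
  cases b <;> simp only [edgeParam, Bool.false_eq_true, if_false, if_true] <;>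
    constructor <;> linarith

theorem edgeParam_mem_ball (b : Bool) {s : ℝ} (hs : s ∈ Ioo (0 : ℝ) 1) :
    edgeParam b s ∈ ball (0 : Fin 1 → ℝ) 1 := by
  rw [mem_ball_zero_iff, pi_norm_lt_iff zero_lt_one]
  intro i
  rw [Real.norm_eq_abs, abs_lt]
  obtain ⟨h1, h2⟩ := hs
  cases b <;> simp only [edgeParam, Bool.false_eq_true, if_false, if_true] <;>
    constructor <;> linarith

theorem const_one_mem_sphere : (fun _ => 1 : Fin 1 → ℝ) ∈ sphere (0 : Fin 1 → ℝ) 1 := by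
  simp

theorem const_neg_one_mem_sphere : (fun _ => -1 : Fin 1 → ℝ) ∈ sphere (0 : Fin 1 → ℝ) 1 := by
  simp

theorem eq_const_of_mem_sphere {w : Fin 1 → ℝ} (hw : w ∈ sphere (0 : Fin 1 → ℝ) 1) :
    w = (fun _ => 1) ∨ w = fun _ => -1 := by
  have h1 : ‖w‖ = |w 0| := by
    rw [← Real.norm_eq_abs]
    refine le_antisymm ((pi_norm_le_iff_of_nonneg (norm_nonneg _)).2 fun i => ?_) (norm_le_pi_norm w 0)
    rw [Subsingleton.elim i 0]
  rw [mem_sphere_zero_iff_norm, h1] at hw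
  rcases (abs_eq zero_le_one).1 hw with h | h
  · exact Or.inl (funext fun i => by rw [Subsingleton.elim i 0, h])
  · exact Or.inr (funext fun i => by rw [Subsingleton.elim i 0, h])

theorem edgeParam_zero (b : Bool) : edgeParam b 0 = fun _ => if b then -1 else 1 := by
  funext i
  cases b <;> simp [edgeParam]

theorem edgeParam_one (b : Bool) : edgeParam b 1 = fun _ => if b then 1 else -1 := by
  funext i
  cases b <;> simp [edgeParam] <;> norm_num

theorem edgePoint_eq (a : Cell B 1 × Bool) (s : ℝ) :
    edgePoint a s = charMap a.1 (edgeParam a.2 s) := rfl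

variable {g : K → B} {n : ℕ} {c c' : Cell K n} {x x' : Cell B n} {ψ ψ' : (Fin n → ℝ) → K}

namespace IsCellLift

theorem mem_openCell (h : IsCellLift g c x ψ) {z : Fin n → ℝ} (hz : z ∈ ball 0 1) :
    ψ z ∈ openCell c := h.image_ball ▸ mem_image_of_mem ψ hz

theorem comp_eq_of_mem_ball (h : IsCellLift g c x ψ) {z : Fin n → ℝ} (hz : z ∈ ball 0 1) :
    g (ψ z) = charMap x z := h.comp_eq z (ball_subset_closedBall hz)

theorem injOn (h : IsCellLift g c x ψ) : InjOn ψ (ball 0 1) := fun z hz w hw hzw => by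
  refine charMap_injOn x hz hw ?_
  rw [← h.comp_eq_of_mem_ball hz, hzw, h.comp_eq_of_mem_ball hw]

theorem cellMap_eq (h : IsCellLift g c x ψ) (hg : IsImmersion g) : hg.cellMap c = x := by
  have h0 : (0 : Fin n → ℝ) ∈ ball (0 : Fin n → ℝ) 1 := by simp
  refine cell_eq_of_mem_openCell (hg.map_mem_openCell (h.mem_openCell h0)) ?_
  rw [h.comp_eq_of_mem_ball h0]
  exact charMap_mem_openCell x h0

theorem mem_skel (h : IsCellLift g c x ψ) (hg : IsImmersion g) {z : Fin n → ℝ}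
    (hz : z ∈ sphere 0 1) : ψ z ∈ skel K n := by
  rw [← hg.map_mem_skel_iff, h.comp_eq z (sphere_subset_closedBall hz)]
  exact charMap_mem_skel x hz

theorem eqOn (h : IsCellLift g c x ψ) (hg : IsImmersion g) (h' : IsCellLift g c' x ψ')
    {z : Fin n → ℝ} (hz : z ∈ closedBall 0 1) (hzz : ψ z = ψ' z) :
    EqOn ψ ψ' (closedBall 0 1) :=
  hg.eqOn_of_comp_eqOn isPreconnected_closedBall h.continuousOn h'.continuousOn
    (fun z hz => (h.comp_eq z hz).trans (h'.comp_eq z hz).symm) hz hzz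

theorem cell_eq (h : IsCellLift g c x ψ) (hg : IsImmersion g) (h' : IsCellLift g c' x ψ')
    {z : Fin n → ℝ} (hz : z ∈ closedBall 0 1) (hzz : ψ z = ψ' z) : c = c' := by
  have h0 : (0 : Fin n → ℝ) ∈ ball (0 : Fin n → ℝ) 1 := by simp
  refine cell_eq_of_mem_openCell (h.mem_openCell h0) ?_
  rw [h.eqOn hg h' hz hzz (ball_subset_closedBall h0)]
  exact h'.mem_openCell h0

/-- Both lifts send the centre to the unique point of the open cell `c` over the centre of `x`. So
the lift, and with it the root, depends only on `c`. -/
theorem eqOn_of_cell (h : IsCellLift g c x ψ) (hg : IsImmersion g) (h' : IsCellLift g c x' ψ') :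
    EqOn ψ ψ' (closedBall 0 1) := by
  obtain rfl : x = x' := (h.cellMap_eq hg).symm.trans (h'.cellMap_eq hg)
  have h0 : (0 : Fin n → ℝ) ∈ ball (0 : Fin n → ℝ) 1 := by simp
  refine h.eqOn hg h' (ball_subset_closedBall h0)
    ((hg.bijOn c).injOn (h.mem_openCell h0) (h'.mem_openCell h0) ?_)
  rw [h.comp_eq_of_mem_ball h0, h'.comp_eq_of_mem_ball h0]

/-- The image is compact, hence closed, and the open disk is dense in the disk. This allows
closedness in `K` to be tested along the lifts `ψ` in place of the given characteristic maps. -/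
theorem image_closedBall (h : IsCellLift g c x ψ) :
    ψ '' closedBall 0 1 = (RelCWComplex.closedCell n c : Set K) := by
  rw [← RelCWComplex.closure_openCell_eq_closedCell]
  apply Subset.antisymm
  · have := h.continuousOn
    rw [closedBall_eq_closure_ball] at this ⊢
    refine this.image_closure.trans ?_
    rw [h.image_ball]; rfl
  · refine closure_minimal ?_ ((isCompact_closedBall 0 1).image_of_continuousOn h.continuousOn).isClosed
    refine Eq.subset (h.image_ball).symm |>.trans (image_mono ball_subset_closedBall)

/-- A set meets a closed cell in a closed set if its preimage in the disk is closed. -/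
theorem isClosed_inter_closedCell (h : IsCellLift g c x ψ) {A : Set K}
    (hA : IsClosed (closedBall 0 1 ∩ ψ ⁻¹' A)) :
    IsClosed (A ∩ (RelCWComplex.closedCell n c : Set K)) := by
  have h1 : A ∩ (RelCWComplex.closedCell n c : Set K) = ψ '' (closedBall 0 1 ∩ ψ ⁻¹' A) := by
    rw [← h.image_closedBall]
    ext y
    constructor
    · rintro ⟨hy, z, hz, rfl⟩
      exact ⟨z, ⟨hz, hy⟩, rfl⟩
    · rintro ⟨z, ⟨hz, hy⟩, rfl⟩
      exact ⟨hy, z, hz, rfl⟩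
  rw [h1]
  exact (((isCompact_closedBall 0 1).of_isClosed_subset hA inter_subset_left).image_of_continuousOn
    (h.continuousOn.mono inter_subset_left)).isClosed

end IsCellLift

theorem IsImmersion.exists_isCellLift_of_mem_ball (hg : IsImmersion g) {y : K} {z : Fin n → ℝ}
    (hz : z ∈ ball 0 1) (hy : g y = charMap x z) :
    ∃ (c : Cell K n) (ψ : _), IsCellLift g c x ψ ∧ ψ z = y := by
  obtain ⟨c, hc, hcx⟩ := hg.exists_mem_openCell (hy ▸ charMap_mem_openCell x hz)
  subst hcx
  obtain ⟨ψ, hψ⟩ := hg.exists_isCellLift c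
  refine ⟨c, ψ, hψ, (hg.bijOn c).injOn (hψ.mem_openCell hz) hc ?_⟩
  rw [hψ.comp_eq_of_mem_ball hz, hy]

/-- A continuous map on the disk lying over a characteristic map is a characteristic map. -/
theorem IsImmersion.exists_isCellLift_of_comp_eq (hg : IsImmersion g)
    (hψ : ContinuousOn ψ (closedBall 0 1)) (hx : ∀ z ∈ closedBall 0 1, g (ψ z) = charMap x z) :
    ∃ c, IsCellLift g c x ψ := by
  have h0 : (0 : Fin n → ℝ) ∈ ball (0 : Fin n → ℝ) 1 := by simp
  obtain ⟨c, ψ', hψ', h⟩ := hg.exists_isCellLift_of_mem_ball h0 (hx 0 (ball_subset_closedBall h0))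
  have he : EqOn ψ' ψ (closedBall 0 1) :=
    hg.eqOn_of_comp_eqOn isPreconnected_closedBall hψ'.continuousOn hψ
      (fun z hz => (hψ'.comp_eq z hz).trans (hx z hz).symm) (ball_subset_closedBall h0) h
  refine ⟨c, hψ, ?_, hx⟩
  rw [← hψ'.image_ball]
  exact (image_congr fun z hz => he (ball_subset_closedBall hz)).symm

/-- A path lying over a directed edge of the base runs along an edge. -/
theorem IsImmersion.exists_edge_of_path (hg : IsImmersion g) {γ : ℝ → K}
    (hγ : ContinuousOn γ (Icc 0 1)) {a : Cell B 1 × Bool}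
    (ha : ∀ s ∈ Icc (0 : ℝ) 1, g (γ s) = edgePoint a s) :
    ∃ (e : Cell K 1) (ψ : _), IsCellLift g e a.1 ψ ∧
      ∀ s ∈ Icc (0 : ℝ) 1, γ s = ψ (edgeParam a.2 s) := by
  -- The midpoint is interior to the 1-cell, where the cell upstairs is known; uniqueness of lifts
  -- carries the agreement to the endpoints.
  have hs : (1 / 2 : ℝ) ∈ Icc (0 : ℝ) 1 := by constructor <;> norm_num
  have hb := edgeParam_mem_ball a.2 (s := 1 / 2) (by constructor <;> norm_num)
  obtain ⟨e, ψ, hψ, h⟩ := hg.exists_isCellLift_of_mem_ball hb (ha _ hs)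
  refine ⟨e, ψ, hψ, hg.eqOn_of_comp_eqOn isPreconnected_Icc hγ ?_ ?_ hs h.symm⟩
  · exact hψ.continuousOn.comp (continuous_edgeParam a.2).continuousOn
      fun s hs => edgeParam_mem_closedBall a.2 hs
  · intro s hs
    rw [ha s hs, hψ.comp_eq _ (edgeParam_mem_closedBall a.2 hs)]
    rfl

end CellLifts

/-! ### Boundary walks, letter by letter -/

section BoundaryWalks

variable {B : Type w} [TopologicalSpace B] [CWComplex (univ : Set B)]

/-- The form of the walk used below: one unit interval per letter, which together exhaust the
circle. -/
theorem IsBoundaryWalk.exists_param {ρ : Cell B 2} {x₀ : Fin 2 → ℝ} {a : List (Cell B 1 × Bool)}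
    (h : IsBoundaryWalk ρ x₀ a) (ha : a ≠ []) : ∃ θ : ℝ → (Fin 2 → ℝ),
    (∀ i : Fin a.length, ContinuousOn (fun s : ℝ => θ ((i : ℕ) + s)) (Icc 0 1)) ∧
    θ 0 = x₀ ∧ θ (a.length : ℝ) = x₀ ∧
    (∀ i : Fin a.length, ∀ s ∈ Icc (0 : ℝ) 1, θ ((i : ℕ) + s) ∈ sphere (0 : Fin 2 → ℝ) 1) ∧
    (∀ z ∈ sphere (0 : Fin 2 → ℝ) 1, ∃ i : Fin a.length, ∃ s ∈ Icc (0 : ℝ) 1,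
      θ ((i : ℕ) + s) = z) ∧
    ∀ (i : Fin a.length), ∀ s ∈ Icc (0 : ℝ) 1,
      charMap ρ (θ ((i : ℕ) + s)) = edgePoint (a.get i) s := by
  obtain ⟨θ, hc, -, him, h0, h1, hw⟩ := h.of_ne_nil ha
  have hmem : ∀ (i : Fin a.length), ∀ s ∈ Icc (0 : ℝ) 1,
      ((i : ℕ) + s : ℝ) ∈ Icc 0 (a.length : ℝ) := by
    intro i s hs
    have h2 : ((i : ℕ) : ℝ) + 1 ≤ a.length := by exact_mod_cast i.2
    exact ⟨add_nonneg (Nat.cast_nonneg _) hs.1, by linarith [hs.2]⟩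
  refine ⟨θ, fun i => ?_, h0, h1, fun i s hs => him ▸ mem_image_of_mem θ (hmem i s hs), ?_, hw⟩
  · exact hc.comp (by fun_prop) fun s hs => hmem i s hs
  · intro z hz
    rw [← him] at hz
    obtain ⟨t, ht, rfl⟩ := hz
    have hpos : 0 < a.length := List.length_pos_iff.2 ha
    rcases ht.2.eq_or_lt with h2 | h2
    -- The final time belongs to the end of the last letter, since its integer part is not a valid
    -- index.
    · refine ⟨⟨a.length - 1, by omega⟩, 1, by simp, ?_⟩
      congr 1
      rw [h2, Nat.cast_sub (by omega)]
      simp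
    · refine ⟨⟨⌊t⌋₊, (Nat.floor_lt ht.1).2 h2⟩, t - ⌊t⌋₊, ⟨?_, ?_⟩, by simp⟩
      · linarith [Nat.floor_le ht.1]
      · linarith [Nat.lt_floor_add_one t]

end BoundaryWalks

/-! ### Determinism of the labeled graph -/

section Graph

variable {B : Type w} [TopologicalSpace B] [T2Space B] [CWComplex (univ : Set B)]
variable {K : Type u} [TopologicalSpace K] [T2Space K] [CWComplex (univ : Set K)]
variable {W : BouquetComplex B} {g : K → B}

/-- The label of the inverse edge. -/
def invLabel : (Cell B 1 × Bool) ⊕ Cell B 2 → (Cell B 1 × Bool) ⊕ Cell B 2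
  | Sum.inl (x, b) => Sum.inl (x, !b)
  | Sum.inr ρ => Sum.inr ρ

theorem label_inv {p q : Vertex W g} (e : Arrow W g p q) : e.inv.label = invLabel e.label := by
  cases e <;> rfl

theorem label_reverse {p q : Vertex W g} (e : p ⟶ q) :
    Arrow.label (Quiver.reverse e) = invLabel (Arrow.label e) := label_inv e

theorem pathLabel_cons {p q r : Vertex W g} (a : Quiver.Path p q) (e : q ⟶ r) :
    pathLabel (a.cons e) = pathLabel a ++ [Arrow.label e] := rfl

theorem pathLabel_nil {p : Vertex W g} : pathLabel (Quiver.Path.nil : Quiver.Path p p) = [] := rfl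

theorem pathLabel_toPath {p q : Vertex W g} (e : p ⟶ q) :
    pathLabel e.toPath = [Arrow.label e] := rfl

theorem pathLabel_comp {p q r : Vertex W g} (a : Quiver.Path p q) (b : Quiver.Path q r) :
    pathLabel (a.comp b) = pathLabel a ++ pathLabel b := by
  induction b with
  | nil => simp [pathLabel_nil]
  | cons b e ih => rw [Quiver.Path.comp_cons, pathLabel_cons, ih, pathLabel_cons, List.append_assoc]

theorem pathLabel_reverse {p q : Vertex W g} (a : Quiver.Path p q) :
    pathLabel a.reverse = ((pathLabel a).map invLabel).reverse := by
  induction a with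
  | nil => rfl
  | cons a e ih =>
    rw [Quiver.Path.reverse, pathLabel_comp, ih, pathLabel_toPath, pathLabel_cons, label_reverse]
    simp

/-- Edges with the same initial vertex and the same label are equal. -/
theorem arrow_eq_of_label_eq (hg : IsImmersion g) {p q r : Vertex W g} (a : Arrow W g p q)
    (b : Arrow W g p r) (h : a.label = b.label) :
    (⟨q, a⟩ : Σ q, Arrow W g p q) = ⟨r, b⟩ := by
  have h1 : (fun _ => 1 : Fin 1 → ℝ) ∈ closedBall (0 : Fin 1 → ℝ) 1 :=
    sphere_subset_closedBall const_one_mem_sphere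
  have h2 : (fun _ => -1 : Fin 1 → ℝ) ∈ closedBall (0 : Fin 1 → ℝ) 1 :=
    sphere_subset_closedBall const_neg_one_mem_sphere
  cases a with
  | pos e x ha =>
    cases b with
    | pos e' x' hb =>
      obtain rfl : x = x' := by simpa [Arrow.label] using h
      have ⟨ψ, hψ, hp, hq⟩ := ha
      have ⟨ψ', hψ', hp', hq'⟩ := hb
      obtain rfl := hψ.cell_eq hg hψ' h2 (hp.trans hp'.symm)
      obtain rfl : q = r := Vertex.ext (hq.symm.trans
        ((hψ.eqOn hg hψ' h2 (hp.trans hp'.symm) h1).trans hq'))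
      rfl
    | neg e' x' hb => simp [Arrow.label] at h
    | face c ρ hb => simp [Arrow.label] at h
  | neg e x ha =>
    cases b with
    | neg e' x' hb =>
      obtain rfl : x = x' := by simpa [Arrow.label] using h
      have ⟨ψ, hψ, hq, hp⟩ := ha
      have ⟨ψ', hψ', hq', hp'⟩ := hb
      obtain rfl := hψ.cell_eq hg hψ' h1 (hp.trans hp'.symm)
      obtain rfl : q = r := Vertex.ext (hq.symm.trans
        ((hψ.eqOn hg hψ' h1 (hp.trans hp'.symm) h2).trans hq'))
      rfl
    | pos e' x' hb => simp [Arrow.label] at h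
    | face c ρ hb => simp [Arrow.label] at h
  | face c ρ ha =>
    cases b with
    | face c' ρ' hb =>
      obtain rfl : ρ = ρ' := by simpa [Arrow.label] using h
      have ⟨ψ, hψ, hp⟩ := ha
      have ⟨ψ', hψ', hp'⟩ := hb
      obtain rfl := hψ.cell_eq hg hψ'
        (sphere_subset_closedBall (W.isBoundaryWalk ρ).mem_sphere) (hp.trans hp'.symm)
      rfl
    | pos e' x' hb => simp [Arrow.label] at h
    | neg e' x' hb => simp [Arrow.label] at h

/-- Paths with the same initial vertex and the same label are equal. -/
theorem path_eq_of_label_eq (hg : IsImmersion g) {p q : Vertex W g} (a : Quiver.Path p q) :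
    ∀ {r : Vertex W g} (b : Quiver.Path p r), pathLabel a = pathLabel b →
      (⟨q, a⟩ : Σ q, Quiver.Path p q) = ⟨r, b⟩ := by
  induction a with
  | nil =>
    intro r b h
    cases b with
    | nil => rfl
    | cons b e => simp [pathLabel] at h
  | cons a e ih =>
    intro r b h
    cases b with
    | nil => simp [pathLabel] at h
    | cons b e' =>
      rw [pathLabel_cons, pathLabel_cons] at h
      obtain ⟨h1, h2⟩ := List.append_inj' h rfl
      have h3 := ih b h1
      obtain ⟨rfl, h4⟩ := Sigma.mk.inj_iff.1 h3
      obtain rfl := eq_of_heq h4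
      have h5 := arrow_eq_of_label_eq hg e e' (List.singleton_inj.1 h2)
      obtain ⟨rfl, h6⟩ := Sigma.mk.inj_iff.1 h5
      obtain rfl := eq_of_heq h6
      rfl

theorem target_eq_of_label_eq (hg : IsImmersion g) {p q r : Vertex W g} (a : Quiver.Path p q)
    (b : Quiver.Path p r) (h : pathLabel a = pathLabel b) : q = r :=
  (Sigma.mk.inj_iff.1 (path_eq_of_label_eq hg a b h)).1

theorem eq_of_label_eq (hg : IsImmersion g) {p q : Vertex W g} (a b : Quiver.Path p q)
    (h : pathLabel a = pathLabel b) : a = b :=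
  eq_of_heq (Sigma.mk.inj_iff.1 (path_eq_of_label_eq hg a b h)).2

/-- Each letter of the label comes from one edge, so a factorization of the word cuts the path at
vertices. This is how subpaths are extracted from words throughout. -/
theorem exists_split_of_label {p q : Vertex W g} (a : Quiver.Path p q) :
    ∀ (l m : List ((Cell B 1 × Bool) ⊕ Cell B 2)), pathLabel a = l ++ m →
      ∃ (r : Vertex W g) (b : Quiver.Path p r) (c : Quiver.Path r q),
        a = b.comp c ∧ pathLabel b = l ∧ pathLabel c = m := by
  induction a with
  | nil =>
    intro l m h
    obtain ⟨rfl, rfl⟩ := List.append_eq_nil_iff.1 (h.symm.trans pathLabel_nil)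
    exact ⟨_, .nil, .nil, rfl, rfl, rfl⟩
  | cons a e ih =>
    intro l m h
    rw [pathLabel_cons] at h
    rcases List.eq_nil_or_concat m with rfl | ⟨m, t, rfl⟩
    · exact ⟨_, a.cons e, .nil, rfl, by simpa [pathLabel_cons] using h, rfl⟩
    · rw [List.concat_eq_append, ← List.append_assoc] at h
      obtain ⟨h1, h2⟩ := List.append_inj' h rfl
      obtain ⟨r, b, c, rfl, hb, hc⟩ := ih l m h1
      refine ⟨r, b, c.cons e, rfl, hb, ?_⟩
      rw [pathLabel_cons, hc, h2, List.concat_eq_append]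

theorem exists_arrow_of_label {p q : Vertex W g} (a : Quiver.Path p q)
    {t : (Cell B 1 × Bool) ⊕ Cell B 2} (h : pathLabel a = [t]) :
    ∃ e : p ⟶ q, a = e.toPath ∧ Arrow.label e = t := by
  cases a with
  | nil => simp [pathLabel_nil] at h
  | cons a e =>
    rw [pathLabel_cons] at h
    cases a with
    | nil => exact ⟨e, rfl, by simpa [pathLabel_nil] using h⟩
    | cons a e' =>
      rw [pathLabel_cons] at h
      have := congrArg List.length h
      simp at this

theorem eq_of_arrow_label_inr {p q : Vertex W g} (e : Arrow W g p q) {ρ : Cell B 2}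
    (h : e.label = Sum.inr ρ) : p = q := by
  cases e with
  | pos e x he => simp [Arrow.label] at h
  | neg e x he => simp [Arrow.label] at h
  | face c ρ he => rfl

theorem isFace_of_arrow_label_inr {p q : Vertex W g} (e : Arrow W g p q) {ρ : Cell B 2}
    (h : e.label = Sum.inr ρ) : ∃ c, IsFace g c ρ (W.root ρ) p.pt := by
  cases e with
  | pos e x he => simp [Arrow.label] at h
  | neg e x he => simp [Arrow.label] at h
  | face c ρ' he =>
    obtain rfl : ρ' = ρ := by simpa [Arrow.label] using h
    exact ⟨c, he⟩

theorem IsCellLift.exists_vertex (hg : IsImmersion g) {e : Cell K 1} {x : Cell B 1}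
    {ψ : (Fin 1 → ℝ) → K} (h : IsCellLift g e x ψ) {z : Fin 1 → ℝ} (hz : z ∈ sphere 0 1) :
    ∃ q : Vertex W g, q.pt = ψ z :=
  ⟨⟨ψ z, isVertex_iff_mem_skel.2 (h.mem_skel hg hz)⟩, rfl⟩

theorem edgeParam_zero_mem_sphere (b : Bool) : edgeParam b 0 ∈ sphere (0 : Fin 1 → ℝ) 1 := by
  rw [edgeParam_zero]
  cases b
  · exact const_one_mem_sphere
  · exact const_neg_one_mem_sphere

theorem edgeParam_one_mem_sphere (b : Bool) : edgeParam b 1 ∈ sphere (0 : Fin 1 → ℝ) 1 := by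
  rw [edgeParam_one]
  cases b
  · exact const_neg_one_mem_sphere
  · exact const_one_mem_sphere

/-- The edge of `Γ_K` that traverses a given 1-cell in a given direction. -/
theorem IsCellLift.exists_arrow {e : Cell K 1} {x : Cell B 1} {ψ : (Fin 1 → ℝ) → K}
    (h : IsCellLift g e x ψ) (b : Bool) {p q : Vertex W g} (hp : p.pt = ψ (edgeParam b 0))
    (hq : q.pt = ψ (edgeParam b 1)) : ∃ a : Arrow W g p q, a.label = Sum.inl (x, b) := by
  rw [edgeParam_zero] at hp
  rw [edgeParam_one] at hq
  cases b with
  | true => exact ⟨.pos e x ⟨ψ, h, hp.symm, hq.symm⟩, rfl⟩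
  | false => exact ⟨.neg e x ⟨ψ, h, hq.symm, hp.symm⟩, rfl⟩

/-- Going around the boundary of a 2-cell from its root, up to the end of the `k`-th letter. -/
theorem IsCellLift.exists_boundary_path (hg : IsImmersion g) {c : Cell K 2} {ρ : Cell B 2}
    {ψ : (Fin 2 → ℝ) → K} (h : IsCellLift g c ρ ψ) {a : List (Cell B 1 × Bool)}
    {θ : ℝ → (Fin 2 → ℝ)}
    (hc : ∀ i : Fin a.length, ContinuousOn (fun s : ℝ => θ ((i : ℕ) + s)) (Icc 0 1))
    (hS : ∀ i : Fin a.length, ∀ s ∈ Icc (0 : ℝ) 1,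
      θ ((i : ℕ) + s) ∈ sphere (0 : Fin 2 → ℝ) 1)
    (hw : ∀ (i : Fin a.length), ∀ s ∈ Icc (0 : ℝ) 1,
      charMap ρ (θ ((i : ℕ) + s)) = edgePoint (a.get i) s)
    {p : Vertex W g} (hp : p.pt = ψ (θ 0)) (k : ℕ) (hk : k ≤ a.length) :
    ∃ (q : Vertex W g) (b : Quiver.Path p q), q.pt = ψ (θ k) ∧
      pathLabel b = (a.take k).map Sum.inl := by
  induction k with
  | zero => exact ⟨p, .nil, by simpa using hp, rfl⟩
  | succ k ih =>
    obtain ⟨q, b, hq, hb⟩ := ih (by omega)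
    obtain ⟨e, φ, hφ, he⟩ := hg.exists_edge_of_path (γ := fun s => ψ (θ ((k : ℕ) + s)))
      (a := a.get ⟨k, hk⟩)
      (h.continuousOn.comp (hc ⟨k, hk⟩) fun s hs => sphere_subset_closedBall (hS ⟨k, hk⟩ s hs))
      (fun s hs => by
        rw [← hw ⟨k, hk⟩ s hs]
        exact h.comp_eq _ (sphere_subset_closedBall (hS ⟨k, hk⟩ s hs)))
    obtain ⟨r, hr⟩ := hφ.exists_vertex (W := W) hg (edgeParam_one_mem_sphere (a.get ⟨k, hk⟩).2)
    obtain ⟨t, ht⟩ := hφ.exists_arrow (a.get ⟨k, hk⟩).2 (p := q) (q := r)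
      (by rw [hq, ← he 0 (by simp)]; simp) hr
    refine ⟨r, b.cons t, ?_, ?_⟩
    · rw [hr, ← he 1 (by simp)]
      simp
    · rw [pathLabel_cons, hb, ht, List.take_add_one, List.getElem?_eq_getElem hk,
        List.map_append]
      rfl

/-- The boundary of a 2-cell, read from its root, is a closed path. -/
theorem IsFace.exists_boundary_path (hg : IsImmersion g) {c : Cell K 2} {ρ : Cell B 2}
    {p : Vertex W g} (h : IsFace g c ρ (W.root ρ) p.pt) :
    ∃ b : Quiver.Path p p, pathLabel b = (W.bl ρ).map Sum.inl := by
  obtain ⟨ψ, hψ, hp⟩ := h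
  by_cases hbl : W.bl ρ = []
  · exact ⟨.nil, by rw [hbl]; rfl⟩
  obtain ⟨θ, hc, h0, h1, hS, -, hw⟩ := (W.isBoundaryWalk ρ).exists_param hbl
  obtain ⟨q, b, hq, hb⟩ := hψ.exists_boundary_path hg hc hS hw (p := p)
    (by rw [h0, hp]) _ le_rfl
  obtain rfl : q = p := Vertex.ext (by rw [hq, h1, hp])
  exact ⟨b, by rw [hb, List.take_length]⟩

end Graph

/-! ### Transfer of relations along labels, and the loop monoid -/

section Lifting

variable {B : Type w} [TopologicalSpace B] [T2Space B] [CWComplex (univ : Set B)]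
variable {K : Type u} [TopologicalSpace K] [T2Space K] [CWComplex (univ : Set K)]
variable {L : Type v} [TopologicalSpace L] [T2Space L] [CWComplex (univ : Set L)]
variable {W : BouquetComplex B} {gK : K → B} {gL : L → B}

/-- The class of a path in the inverse category. -/
def pathClass {p q : Vertex W gK} (a : Quiver.Path p q) :
    (CategoryTheory.Quotient.functor (pathHomRel W gK)).obj p ⟶
      (CategoryTheory.Quotient.functor (pathHomRel W gK)).obj q :=
  (CategoryTheory.Quotient.functor (pathHomRel W gK)).map (X := p) (Y := q) a

theorem pathClass_comp {p q r : Vertex W gK} (a : Quiver.Path p q) (b : Quiver.Path q r) :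
    pathClass (a.comp b) = pathClass a ≫ pathClass b :=
  (CategoryTheory.Quotient.functor (pathHomRel W gK)).map_comp (X := p) (Y := q) (Z := r) a b

theorem PathRel.pathClass_eq {p q : Vertex W gK} {a b : Quiver.Path p q} (h : PathRel a b) :
    pathClass a = pathClass b :=
  CategoryTheory.Quotient.sound (pathHomRel W gK) h

theorem exists_pathClass {p q : Vertex W gK}
    (m : (CategoryTheory.Quotient.functor (pathHomRel W gK)).obj p ⟶
      (CategoryTheory.Quotient.functor (pathHomRel W gK)).obj q) :
    ∃ a : Quiver.Path p q, pathClass a = m :=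
  Quot.exists_rep m

/-- A generating relation transfers to the paths with the same labels, from left to right. -/
theorem PathRel.lift_left (hK : IsImmersion gK) {s t : Vertex W gL} {a' b' : Quiver.Path s t}
    (h : PathRel a' b') {p q : Vertex W gK} (a : Quiver.Path p q)
    (ha : pathLabel a = pathLabel a') :
    ∃ b : Quiver.Path p q, pathLabel b = pathLabel b' ∧ PathRel a b := by
  cases h with
  | regular a' =>
    exact ⟨(a.comp a.reverse).comp a, by simp only [pathLabel_comp, pathLabel_reverse, ha],
      .regular a⟩
  | commute a' b' =>
    simp only [pathLabel_comp, pathLabel_reverse] at ha ⊢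
    obtain ⟨r, a1, a2, rfl, h1, h2⟩ := exists_split_of_label a _ _ ha
    obtain ⟨r1, a3, a4, rfl, h3, h4⟩ := exists_split_of_label a1 _ _ h1
    obtain ⟨r2, a5, a6, rfl, h5, h6⟩ := exists_split_of_label a2 _ _ h2
    -- The second piece reads the inverse word of `a3` from the end of `a3`, so by determinism it is
    -- `a3` reversed and returns to `p`.
    obtain rfl : p = r := target_eq_of_label_eq hK a3.reverse a4
      (by rw [pathLabel_reverse, h3, h4])
    obtain rfl : p = q := target_eq_of_label_eq hK a5.reverse a6
      (by rw [pathLabel_reverse, h5, h6])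
    obtain rfl : a3.reverse = a4 := eq_of_label_eq hK _ _ (by rw [pathLabel_reverse, h3, h4])
    obtain rfl : a5.reverse = a6 := eq_of_label_eq hK _ _ (by rw [pathLabel_reverse, h5, h6])
    exact ⟨_, by simp only [pathLabel_comp, pathLabel_reverse, h3, h5], .commute a3 a5⟩
  | idempotent e' ρ he' =>
    rw [pathLabel_toPath, he'] at ha
    obtain ⟨e, rfl, he⟩ := exists_arrow_of_label a ha
    obtain rfl := eq_of_arrow_label_inr e he
    exact ⟨_, by rw [pathLabel_comp, pathLabel_comp, pathLabel_toPath, pathLabel_toPath, he, he'],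
      .idempotent e ρ he⟩
  | boundary e' ρ he' b' hb' =>
    rw [pathLabel_toPath, he'] at ha
    obtain ⟨e, rfl, he⟩ := exists_arrow_of_label a ha
    obtain rfl := eq_of_arrow_label_inr e he
    obtain ⟨c, hc⟩ := isFace_of_arrow_label_inr e he
    -- The path to be inserted is not part of `a`; it is produced by the 2-cell itself, whose
    -- boundary lifts to a closed path at its root.
    obtain ⟨b, hb⟩ := hc.exists_boundary_path hK
    exact ⟨_, by rw [pathLabel_comp, pathLabel_comp, pathLabel_toPath, pathLabel_toPath, he, he',
      hb, hb'], .boundary e ρ he b hb⟩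

/-- A generating relation transfers to the paths with the same labels, from right to left. -/
theorem PathRel.lift_right (hK : IsImmersion gK) {s t : Vertex W gL} {a' b' : Quiver.Path s t}
    (h : PathRel a' b') {p q : Vertex W gK} (b : Quiver.Path p q)
    (hb : pathLabel b = pathLabel b') :
    ∃ a : Quiver.Path p q, pathLabel a = pathLabel a' ∧ PathRel a b := by
  cases h with
  | regular a' =>
    simp only [pathLabel_comp, pathLabel_reverse] at hb
    obtain ⟨r, a1, a2, rfl, h1, h2⟩ := exists_split_of_label b _ _ hb
    obtain ⟨r1, a3, a4, rfl, h3, h4⟩ := exists_split_of_label a1 _ _ h1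
    obtain rfl : p = r := target_eq_of_label_eq hK a3.reverse a4
      (by rw [pathLabel_reverse, h3, h4])
    obtain rfl : r1 = q := target_eq_of_label_eq hK a3 a2 (by rw [h3, h2])
    obtain rfl : a3.reverse = a4 := eq_of_label_eq hK _ _ (by rw [pathLabel_reverse, h3, h4])
    obtain rfl : a3 = a2 := eq_of_label_eq hK _ _ (by rw [h3, h2])
    exact ⟨a3, h3, .regular a3⟩
  | commute a' b' =>
    simp only [pathLabel_comp, pathLabel_reverse] at hb ⊢
    obtain ⟨r, a1, a2, rfl, h1, h2⟩ := exists_split_of_label b _ _ hb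
    obtain ⟨r1, a3, a4, rfl, h3, h4⟩ := exists_split_of_label a1 _ _ h1
    obtain ⟨r2, a5, a6, rfl, h5, h6⟩ := exists_split_of_label a2 _ _ h2
    obtain rfl : p = r := target_eq_of_label_eq hK a3.reverse a4
      (by rw [pathLabel_reverse, h3, h4])
    obtain rfl : p = q := target_eq_of_label_eq hK a5.reverse a6
      (by rw [pathLabel_reverse, h5, h6])
    obtain rfl : a3.reverse = a4 := eq_of_label_eq hK _ _ (by rw [pathLabel_reverse, h3, h4])
    obtain rfl : a5.reverse = a6 := eq_of_label_eq hK _ _ (by rw [pathLabel_reverse, h5, h6])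
    exact ⟨_, by simp only [pathLabel_comp, pathLabel_reverse, h3, h5], .commute a5 a3⟩
  | idempotent e' ρ he' =>
    rw [pathLabel_comp, pathLabel_toPath, he'] at hb
    obtain ⟨r, b1, b2, rfl, h1, h2⟩ := exists_split_of_label b _ _ hb
    obtain ⟨e, rfl, he⟩ := exists_arrow_of_label b1 h1
    obtain rfl := eq_of_arrow_label_inr e he
    obtain rfl : p = q := target_eq_of_label_eq hK e.toPath b2 (by rw [h1, h2])
    obtain rfl : e.toPath = b2 := eq_of_label_eq hK _ _ (by rw [h1, h2])
    exact ⟨e.toPath, by rw [h1, pathLabel_toPath, he'], .idempotent e ρ he⟩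
  | boundary e' ρ he' b' hb' =>
    rw [pathLabel_comp, pathLabel_toPath, he'] at hb
    obtain ⟨r, b1, b2, rfl, h1, h2⟩ := exists_split_of_label b _ _ hb
    obtain ⟨e, rfl, he⟩ := exists_arrow_of_label b1 h1
    obtain rfl := eq_of_arrow_label_inr e he
    obtain ⟨c, hc⟩ := isFace_of_arrow_label_inr e he
    obtain ⟨b, hb⟩ := hc.exists_boundary_path hK
    -- The boundary of the 2-cell is closed, so `b2`, which has the same label and start, is closed
    -- too.
    obtain rfl : p = q := target_eq_of_label_eq hK b b2 (by rw [hb, h2, hb'])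
    exact ⟨e.toPath, by rw [h1, pathLabel_toPath, he'], .boundary e ρ he b2 (by rw [h2, hb'])⟩

theorem pathLabel_comp_comp {p q r s : Vertex W gK} (a : Quiver.Path p q) (b : Quiver.Path q r)
    (c : Quiver.Path r s) :
    pathLabel (a.comp (b.comp c)) = pathLabel a ++ (pathLabel b ++ pathLabel c) := by
  rw [pathLabel_comp, pathLabel_comp]

/-- If two paths represent the same morphism, then a path with the label of the first one has a
coterminal path with the label of the second one, and the two represent the same morphism. -/
theorem exists_path_of_pathClass_eq (hK : IsImmersion gK) {s t : Vertex W gL}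
    {a' b' : Quiver.Path s t} (h : pathClass a' = pathClass b') {p q : Vertex W gK}
    (a : Quiver.Path p q) (ha : pathLabel a = pathLabel a') :
    ∃ b : Quiver.Path p q, pathLabel b = pathLabel b' ∧ pathClass a = pathClass b := by
  have hgen := (CategoryTheory.Quotient.functor_homRel_eq_compClosure_eqvGen (pathHomRel W gL)
    (X := s) (Y := t) a' b').1 h
  -- Both directions are carried through the induction together, because the generated equivalence
  -- is closed under symmetry. An elementary step rewrites a middle factor, and the path over it is
  -- cut at the same two places.
  have key : ∀ a' b' : Quiver.Path s t,
      Relation.EqvGen (@HomRel.CompClosure (Paths (Vertex W gL)) _ (pathHomRel W gL) s t) a' b' →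
      (∀ a : Quiver.Path p q, pathLabel a = pathLabel a' →
        ∃ b : Quiver.Path p q, pathLabel b = pathLabel b' ∧ pathClass a = pathClass b) ∧
      (∀ b : Quiver.Path p q, pathLabel b = pathLabel b' →
        ∃ a : Quiver.Path p q, pathLabel a = pathLabel a' ∧ pathClass a = pathClass b) := by
    intro a' b' h
    induction h with
    | rel a' b' h =>
      obtain ⟨u, w, l, m, m', r, hm⟩ := h
      have e1 : ∀ m : Quiver.Path (V := Vertex W gL) u w,
          pathLabel (p := s) (q := t) (Quiver.Path.comp l (Quiver.Path.comp m r)) =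
            pathLabel l ++ (pathLabel m ++ pathLabel r) := fun m =>
        pathLabel_comp_comp (p := s) (q := u) (r := w) (s := t) l m r
      constructor
      · intro a ha
        obtain ⟨p1, a1, a2, rfl, h1, h2⟩ := exists_split_of_label a _ _ (ha.trans (e1 m))
        obtain ⟨p2, a3, a4, rfl, h3, h4⟩ := exists_split_of_label a2 _ _ h2
        obtain ⟨b, hb, hab⟩ := PathRel.lift_left hK hm a3 h3
        refine ⟨a1.comp (b.comp a4), ?_, ?_⟩
        · rw [pathLabel_comp, pathLabel_comp, h1, hb, h4]
          exact (e1 m').symm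
        · simp only [pathClass_comp, hab.pathClass_eq]
      · intro a ha
        obtain ⟨p1, a1, a2, rfl, h1, h2⟩ := exists_split_of_label a _ _ (ha.trans (e1 m'))
        obtain ⟨p2, a3, a4, rfl, h3, h4⟩ := exists_split_of_label a2 _ _ h2
        obtain ⟨b, hb, hab⟩ := PathRel.lift_right hK hm a3 h3
        refine ⟨a1.comp (b.comp a4), ?_, ?_⟩
        · rw [pathLabel_comp, pathLabel_comp, h1, hb, h4]
          exact (e1 m).symm
        · simp only [pathClass_comp, hab.pathClass_eq]
    | refl a' => exact ⟨fun a ha => ⟨a, ha, rfl⟩, fun a ha => ⟨a, ha, rfl⟩⟩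
    | symm a' b' _ ih =>
      refine ⟨fun a ha => ?_, fun a ha => ?_⟩
      · obtain ⟨b, hb, h⟩ := ih.2 a ha
        exact ⟨b, hb, h.symm⟩
      · obtain ⟨b, hb, h⟩ := ih.1 a ha
        exact ⟨b, hb, h.symm⟩
    | trans a' b' c' _ _ ih1 ih2 =>
      refine ⟨fun a ha => ?_, fun c hc => ?_⟩
      · obtain ⟨b, hb, h⟩ := ih1.1 a ha
        obtain ⟨c, hc, h'⟩ := ih2.1 b hb
        exact ⟨c, hc, h.trans h'⟩
      · obtain ⟨b, hb, h⟩ := ih2.2 c hc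
        obtain ⟨a, ha, h'⟩ := ih1.2 b hb
        exact ⟨a, ha, h'.trans h⟩
  exact (key a' b' hgen).1 a ha

/-- The element of the loop monoid represented by a closed path. -/
def loopClass {p : Vertex W gK} (a : Quiver.Path p p) : LoopMonoid p := MulOpposite.op (pathClass a)

theorem loopClass_eq_iff {p : Vertex W gK} {a b : Quiver.Path p p} :
    loopClass a = loopClass b ↔ pathClass a = pathClass b :=
  MulOpposite.op_injective.eq_iff

theorem exists_loopClass {p : Vertex W gK} (m : LoopMonoid p) :
    ∃ a : Quiver.Path p p, loopClass a = m := by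
  obtain ⟨a, ha⟩ := exists_pathClass m.unop
  exact ⟨a, congrArg MulOpposite.op ha⟩

theorem loopClass_mul {p : Vertex W gK} (a b : Quiver.Path p p) :
    loopClass a * loopClass b = loopClass (a.comp b) := by
  rw [loopClass, loopClass, loopClass, pathClass_comp]
  rfl

section Map

variable {f : K → L} (hf : IsImmersion f) (hlab : gL ∘ f = gK)

/-- The image of a path. -/
noncomputable def imagePath {p q : Vertex W gK} (a : Quiver.Path p q) :
    Quiver.Path (p.map hf : Vertex W gL) (q.map hf) :=
  (graphMap hf hlab).mapPath a

theorem pathLabel_imagePath {p q : Vertex W gK} (a : Quiver.Path p q) :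
    pathLabel (imagePath (gL := gL) hf hlab a) = pathLabel a :=
  pathLabel_map hf hlab a

theorem loopMap_loopClass {p : Vertex W gK} (a : Quiver.Path p p) :
    loopMap hf hlab p (loopClass a) = loopClass (imagePath hf hlab a) := rfl

/-- Pulling the equality of images back to `a` gives a path with the class of `a` and the label of
`a'`; determinism identifies it with `a'`. -/
theorem loopMap_injective (hK : IsImmersion gK) (p : Vertex W gK) :
    Function.Injective (loopMap (gL := gL) hf hlab p) := by
  intro m m' h
  obtain ⟨a, rfl⟩ := exists_loopClass m
  obtain ⟨a', rfl⟩ := exists_loopClass m'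
  rw [loopMap_loopClass, loopMap_loopClass, loopClass_eq_iff] at h
  obtain ⟨b, hb, hab⟩ := exists_path_of_pathClass_eq hK h a (pathLabel_imagePath hf hlab a).symm
  rw [pathLabel_imagePath] at hb
  rw [loopClass_eq_iff, hab, eq_of_label_eq hK b a' hb]

/-- The image of the loop monoid consists of the classes of the closed paths whose label is the
label of a closed path upstairs. -/
theorem loopClass_mem_mrange (hK : IsImmersion gK) (hL : IsImmersion gL) {p : Vertex W gK}
    {a' : Quiver.Path (p.map hf : Vertex W gL) (p.map hf)} :
    loopClass a' ∈ MonoidHom.mrange (loopMap (gL := gL) hf hlab p) ↔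
      ∃ a : Quiver.Path p p, pathLabel a = pathLabel a' := by
  constructor
  · rintro ⟨m, hm⟩
    obtain ⟨a, rfl⟩ := exists_loopClass m
    rw [loopMap_loopClass, loopClass_eq_iff] at hm
    obtain ⟨b, hb, -⟩ := exists_path_of_pathClass_eq hK hm a (pathLabel_imagePath hf hlab a).symm
    exact ⟨b, hb⟩
  · rintro ⟨a, ha⟩
    refine ⟨loopClass a, ?_⟩
    rw [loopMap_loopClass, eq_of_label_eq hL _ a' ((pathLabel_imagePath hf hlab a).trans ha)]

/-- A lift of a path that represents an idempotent is closed. -/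
theorem eq_of_label_eq_idempotent (hK : IsImmersion gK) {s : Vertex W gL} {a' : Quiver.Path s s}
    (h : IsIdempotentElem (loopClass a')) {p q : Vertex W gK} (a : Quiver.Path p q)
    (ha : pathLabel a = pathLabel a') : p = q := by
  have h' : pathClass a' = pathClass (a'.comp a') := by
    rw [← loopClass_eq_iff, ← loopClass_mul]
    exact h.symm
  obtain ⟨b, hb, -⟩ := exists_path_of_pathClass_eq hK h' a ha
  rw [pathLabel_comp] at hb
  obtain ⟨r, b1, b2, rfl, h1, h2⟩ := exists_split_of_label b _ _ hb
  obtain rfl : q = r := target_eq_of_label_eq hK a b1 (ha.trans h1.symm)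
  -- `a` runs from `p` to `q` and `b2` from `q` to `q` with the same label; read backwards from `q`
  -- they must end at the same vertex.
  exact target_eq_of_label_eq hK a.reverse b2.reverse
    (by rw [pathLabel_reverse, pathLabel_reverse, ha, h2])

theorem isIdempotentElem_loopClass {p q : Vertex W gK} (a : Quiver.Path p q) :
    IsIdempotentElem (loopClass (a.comp a.reverse)) := by
  rw [IsIdempotentElem, loopClass_mul, loopClass_eq_iff]
  have := (PathRel.regular a).pathClass_eq
  rw [← Quiver.Path.comp_assoc, pathClass_comp, ← this, ← pathClass_comp]

/-- Every edge at the image of a vertex lifts to an edge at that vertex. -/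
def IsStarSurjective (W : BouquetComplex B) (gK : K → B) (gL : L → B) (f : K → L) : Prop :=
  ∀ (p : Vertex W gK) (s t : Vertex W gL) (e' : Arrow W gL s t), s.pt = f p.pt →
    ∃ (q : Vertex W gK) (e : Arrow W gK p q), e.label = e'.label

/-- Paths lift edge by edge; determinism in `L` makes the image of the partial lift end where the
next edge begins. -/
theorem IsStarSurjective.exists_path (h : IsStarSurjective W gK gL f) (hL : IsImmersion gL)
    (hf : IsImmersion f) (hlab : gL ∘ f = gK) {p : Vertex W gK}
    {s t : Vertex W gL} (hs : p.map hf = s) (a' : Quiver.Path s t) :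
    ∃ (q : Vertex W gK) (a : Quiver.Path p q), pathLabel a = pathLabel a' := by
  subst hs
  induction a' with
  | nil => exact ⟨p, .nil, rfl⟩
  | cons a' e' ih =>
    obtain ⟨q, a, ha⟩ := ih
    have h1 := target_eq_of_label_eq hL a' (imagePath hf hlab a)
      (ha.symm.trans (pathLabel_imagePath hf hlab a).symm)
    obtain ⟨r, e, he⟩ := h q _ _ e' (by rw [h1]; rfl)
    exact ⟨r, a.cons e, by rw [pathLabel_cons, pathLabel_cons, ha, he]⟩

/-- Membership in the image means having a closed lift at `p`. For inverses and for the order, the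
equations `m = m m' m` and `m = i m'` are pulled back to the lift of `m` and a lift of `m'` is cut
out. For idempotents, star surjectivity gives a lift, which is closed by
`eq_of_label_eq_idempotent`. -/
theorem isFullClosed_of_isStarSurjective (hK : IsImmersion gK) (hL : IsImmersion gL)
    (h : IsStarSurjective W gK gL f) (p : Vertex W gK) :
    IsFullClosedInverseSubmonoid (MonoidHom.mrange (loopMap (gL := gL) hf hlab p)) where
  inverse := by
    intro m hm m' hmm'
    obtain ⟨a', rfl⟩ := exists_loopClass m
    obtain ⟨b', rfl⟩ := exists_loopClass m'
    rw [loopClass_mem_mrange hf hlab hK hL] at hm ⊢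
    obtain ⟨a, ha⟩ := hm
    obtain ⟨q, b, hb⟩ := h.exists_path hL hf hlab rfl b'
    have h1 := hmm'.1
    rw [loopClass_mul, loopClass_mul, loopClass_eq_iff] at h1
    obtain ⟨c, hc, -⟩ := exists_path_of_pathClass_eq hK h1.symm a ha
    rw [pathLabel_comp, pathLabel_comp] at hc
    obtain ⟨r, c1, c2, rfl, h2, h3⟩ := exists_split_of_label c _ _ hc
    obtain ⟨r1, c3, c4, rfl, h4, h5⟩ := exists_split_of_label c1 _ _ h2
    -- The first factor reads the label of `a` from `p` and the last reads it into `p`; as `a` is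
    -- closed, the middle factor starts and ends at `p`.
    obtain rfl : p = r1 := target_eq_of_label_eq hK a c3 (ha.trans h4.symm)
    obtain rfl : r = p := target_eq_of_label_eq hK c2.reverse a.reverse
      (by rw [pathLabel_reverse, pathLabel_reverse, h3, ha])
    exact ⟨c4, h5⟩
  closed := by
    rintro m hm m' ⟨i, hi, him⟩
    obtain ⟨a', rfl⟩ := exists_loopClass m
    obtain ⟨b', rfl⟩ := exists_loopClass m'
    obtain ⟨e', rfl⟩ := exists_loopClass i
    rw [loopClass_mem_mrange hf hlab hK hL] at hm ⊢
    obtain ⟨a, ha⟩ := hm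
    rw [loopClass_mul, loopClass_eq_iff] at him
    obtain ⟨c, hc, -⟩ := exists_path_of_pathClass_eq hK him a ha
    rw [pathLabel_comp] at hc
    obtain ⟨r, c1, c2, rfl, h2, h3⟩ := exists_split_of_label c _ _ hc
    -- The lift of the idempotent factor is closed, so `c2` starts at `p`.
    obtain rfl := eq_of_label_eq_idempotent hK hi c1 h2
    exact ⟨c2, h3⟩
  full := by
    intro m hm
    obtain ⟨a', rfl⟩ := exists_loopClass m
    rw [loopClass_mem_mrange hf hlab hK hL]
    obtain ⟨q, a, ha⟩ := h.exists_path hL hf hlab rfl a'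
    obtain rfl := eq_of_label_eq_idempotent hK hm a ha
    exact ⟨a, ha⟩

/-- Go to `q`, cross the given edge, and come back: downstairs this is an idempotent, so its label
is read on a closed path at `p`. By determinism that path passes through `q`, and its next edge is
the one sought. -/
theorem isStarSurjective_of_full (hK : IsImmersion gK) (hL : IsImmersion gL) (p : Vertex W gK)
    (hconn : ∀ q : Vertex W gK, Nonempty (Quiver.Path p q))
    (h : ∀ e : LoopMonoid (p.map hf : Vertex W gL), IsIdempotentElem e →
      e ∈ MonoidHom.mrange (loopMap (gL := gL) hf hlab p)) :
    IsStarSurjective W gK gL f := by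
  intro q s t e' hs
  obtain ⟨a⟩ := hconn q
  obtain rfl : s = q.map hf := Vertex.ext hs
  have h1 := h _ (isIdempotentElem_loopClass
    (Quiver.Path.cons (imagePath (gL := gL) hf hlab a) e'))
  rw [loopClass_mem_mrange hf hlab hK hL] at h1
  obtain ⟨c, hc⟩ := h1
  rw [pathLabel_comp, pathLabel_cons] at hc
  obtain ⟨r, c1, c2, rfl, h2, h3⟩ := exists_split_of_label c _ _ hc
  obtain ⟨r1, c3, c4, rfl, h4, h5⟩ := exists_split_of_label c1 _ _ h2
  obtain rfl : q = r1 := target_eq_of_label_eq hK a c3 (by rw [h4, pathLabel_imagePath])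
  obtain ⟨e, -, he⟩ := exists_arrow_of_label c4 h5
  exact ⟨r, e, he⟩

end Map

end Lifting

/-! ### Connectedness of the graph of a 2-complex -/

section Connectivity

variable {B : Type w} [TopologicalSpace B] [T2Space B] [CWComplex (univ : Set B)]
variable {K : Type u} [TopologicalSpace K] [T2Space K] [CWComplex (univ : Set K)]
variable {W : BouquetComplex B} {g : K → B}

theorem mem_ball_or_mem_sphere {n : ℕ} {z : Fin n → ℝ} (hz : z ∈ closedBall 0 1) :
    z ∈ ball 0 1 ∨ z ∈ sphere 0 1 := by
  rwa [← mem_union, ball_union_sphere]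

theorem IsCellLift.mem_sphere_of_mem_skel {n : ℕ} {c : Cell K n} {x : Cell B n}
    {ψ : (Fin n → ℝ) → K} (h : IsCellLift g c x ψ) {z : Fin n → ℝ} (hz : z ∈ closedBall 0 1)
    (hs : ψ z ∈ skel K n) : z ∈ sphere 0 1 := by
  refine (mem_ball_or_mem_sphere hz).resolve_left fun hb => ?_
  exact absurd ((mem_skel_iff_of_mem_openCell (h.mem_openCell hb)).1 hs) (lt_irrefl n)

/-- The attaching map of a 2-cell with empty boundary label is constant. -/
theorem IsCellLift.eq_of_mem_sphere (hg : IsImmersion g) {c : Cell K 2} {ρ : Cell B 2}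
    {ψ : (Fin 2 → ℝ) → K} (h : IsCellLift g c ρ ψ) (hbl : W.bl ρ = []) {z z' : Fin 2 → ℝ}
    (hz : z ∈ sphere 0 1) (hz' : z' ∈ sphere 0 1) : ψ z = ψ z' := by
  obtain ⟨b, hb⟩ := (W.isBoundaryWalk ρ).of_nil hbl
  have hpre : _root_.IsPreconnected (sphere (0 : Fin 2 → ℝ) 1) :=
    isPreconnected_sphere (by rw [rank_fin_fun]; exact_mod_cast one_lt_two) 0 1
  -- On the connected circle both `ψ` and a constant lift the same constant map, a 0-cell being a
  -- single point.
  refine hg.eqOn_of_comp_eqOn hpre (h.continuousOn.mono sphere_subset_closedBall)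
    (continuousOn_const (c := ψ z')) (fun y hy => ?_) hz' rfl hz
  have h1 := hb y hy
  have h2 := hb z' hz'
  rw [← h.comp_eq _ (sphere_subset_closedBall hy)] at h1
  rw [← h.comp_eq _ (sphere_subset_closedBall hz')] at h2
  obtain ⟨w, hw, hw1⟩ := h1
  obtain ⟨w', hw', hw2⟩ := h2
  rw [← hw1, ← hw2, Subsingleton.elim w w']

/-- In the base the root goes to the start of the first letter, or to the 0-cell of a constant
attaching map; immersions reflect vertices. -/
theorem IsCellLift.isVertex_root (hg : IsImmersion g) {c : Cell K 2} {ρ : Cell B 2}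
    {ψ : (Fin 2 → ℝ) → K} (h : IsCellLift g c ρ ψ) : IsVertex (ψ (W.root ρ)) := by
  have hw := W.isBoundaryWalk ρ
  rw [← hg.isVertex_iff, h.comp_eq _ (sphere_subset_closedBall hw.mem_sphere)]
  by_cases hbl : W.bl ρ = []
  · obtain ⟨b, hb⟩ := hw.of_nil hbl
    exact ⟨b, hb _ hw.mem_sphere⟩
  · obtain ⟨θ, -, h0, -, -, -, he⟩ := hw.exists_param hbl
    have := he ⟨0, List.length_pos_iff.2 hbl⟩ 0 (by simp)
    simp only [Nat.cast_zero, add_zero, h0] at this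
    rw [this, isVertex_iff_mem_skel, edgePoint_eq]
    exact charMap_mem_skel _ (edgeParam_zero_mem_sphere _)

/-- Each boundary point of a 2-cell lies on an edge that starts at a vertex reachable from the
root. -/
theorem IsCellLift.exists_edge_of_mem_sphere (hg : IsImmersion g) {c : Cell K 2} {ρ : Cell B 2}
    {ψ : (Fin 2 → ℝ) → K} (h : IsCellLift g c ρ ψ) (hbl : W.bl ρ ≠ []) {p : Vertex W g}
    (hp : p.pt = ψ (W.root ρ)) {z : Fin 2 → ℝ} (hz : z ∈ sphere 0 1) :
    ∃ (q : Vertex W g) (e : Cell K 1) (x : Cell B 1) (φ : (Fin 1 → ℝ) → K) (z₀ z₁ : Fin 1 → ℝ)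
      (w : Fin 2 → ℝ),
      Nonempty (Quiver.Path p q) ∧ IsCellLift g e x φ ∧ z₀ ∈ closedBall 0 1 ∧
        z₁ ∈ closedBall 0 1 ∧ w ∈ sphere 0 1 ∧ q.pt = ψ w ∧ q.pt = φ z₀ ∧ ψ z = φ z₁ := by
  obtain ⟨θ, hc, h0, h1, hS, hsurj, hw⟩ := (W.isBoundaryWalk ρ).exists_param hbl
  obtain ⟨i, s, hs, rfl⟩ := hsurj z hz
  obtain ⟨q, b, hq, -⟩ := h.exists_boundary_path hg hc hS hw (p := p) (by rw [h0, hp]) i i.2.le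
  obtain ⟨e, φ, hφ, he⟩ := hg.exists_edge_of_path (γ := fun s => ψ (θ ((i : ℕ) + s)))
    (a := (W.bl ρ).get i)
    (h.continuousOn.comp (hc i) fun s hs => sphere_subset_closedBall (hS i s hs))
    (fun s hs => by
      rw [← hw i s hs]
      exact h.comp_eq _ (sphere_subset_closedBall (hS i s hs)))
  have h0 := he 0 (by simp)
  have hS0 := hS i 0 (by simp)
  simp only [add_zero] at h0 hS0
  exact ⟨q, e, _, φ, _, _, _, ⟨b⟩, hφ, edgeParam_mem_closedBall _ (left_mem_Icc.2 zero_le_one),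
    edgeParam_mem_closedBall _ hs, hS0, hq, by rw [hq, h0], he s hs⟩

theorem IsCellLift.nonempty_path_of_edge {e : Cell K 1} {x : Cell B 1}
    {ψ : (Fin 1 → ℝ) → K} (h : IsCellLift g e x ψ) {p q : Vertex W g} {z z' : Fin 1 → ℝ}
    (hz : z ∈ closedBall 0 1) (hz' : z' ∈ closedBall 0 1) (hp : p.pt = ψ z) (hq : q.pt = ψ z') :
    Nonempty (Quiver.Path p q) := by
  have hz1 := h.mem_sphere_of_mem_skel hz (hp ▸ isVertex_iff_mem_skel.1 p.isVertex)
  have hz2 := h.mem_sphere_of_mem_skel hz' (hq ▸ isVertex_iff_mem_skel.1 q.isVertex)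
  rcases eq_const_of_mem_sphere hz1 with rfl | rfl <;>
    rcases eq_const_of_mem_sphere hz2 with rfl | rfl
  · obtain rfl : p = q := Vertex.ext (hp.trans hq.symm)
    exact ⟨.nil⟩
  · exact ⟨Quiver.Hom.toPath (V := Vertex W g) (Arrow.neg e x ⟨ψ, h, hq.symm, hp.symm⟩)⟩
  · exact ⟨Quiver.Hom.toPath (V := Vertex W g) (Arrow.pos e x ⟨ψ, h, hp.symm, hq.symm⟩)⟩
  · obtain rfl : p = q := Vertex.ext (hp.trans hq.symm)
    exact ⟨.nil⟩

/-- The vertices of a closed cell are joined by paths. -/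
theorem IsCellLift.nonempty_path (hg : IsImmersion g) {n : ℕ} (hn : n ≤ 2) {c : Cell K n}
    {x : Cell B n} {ψ : (Fin n → ℝ) → K} (h : IsCellLift g c x ψ) {p q : Vertex W g}
    {z z' : Fin n → ℝ} (hz : z ∈ closedBall 0 1) (hz' : z' ∈ closedBall 0 1) (hp : p.pt = ψ z)
    (hq : q.pt = ψ z') : Nonempty (Quiver.Path p q) := by
  interval_cases n
  · obtain rfl : p = q := Vertex.ext (by rw [hp, hq, Subsingleton.elim z z'])
    exact ⟨.nil⟩
  · exact h.nonempty_path_of_edge hz hz' hp hq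
  · have hz1 := h.mem_sphere_of_mem_skel hz
      (hp ▸ skel_mono one_le_two (isVertex_iff_mem_skel.1 p.isVertex))
    have hz2 := h.mem_sphere_of_mem_skel hz'
      (hq ▸ skel_mono one_le_two (isVertex_iff_mem_skel.1 q.isVertex))
    by_cases hbl : W.bl x = []
    · obtain rfl : p = q := Vertex.ext (by rw [hp, hq, h.eq_of_mem_sphere hg hbl hz1 hz2])
      exact ⟨.nil⟩
    -- The root serves as hub: every vertex on the boundary is reachable from it.
    · have key : ∀ (r : Vertex W g) (y : Fin 2 → ℝ), y ∈ sphere 0 1 → r.pt = ψ y →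
          Nonempty (Quiver.Path (⟨_, h.isVertex_root (W := W) hg⟩ : Vertex W g) r) := by
        intro r y hy hr
        obtain ⟨s, e, x', φ, z₀, z₁, -, ⟨a⟩, hφ, h0, h1, -, -, hs, hy1⟩ :=
          h.exists_edge_of_mem_sphere (W := W) hg hbl (p := ⟨_, h.isVertex_root hg⟩) rfl hy
        obtain ⟨b⟩ := hφ.nonempty_path_of_edge h0 h1 hs (hr.trans hy1)
        exact ⟨a.comp b⟩
      obtain ⟨a⟩ := key p z hz1 hp
      obtain ⟨b⟩ := key q z' hz2 hq
      exact ⟨a.reverse.comp b⟩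

/-- If an open cell meets a closed cell, then their closures have a vertex in common. -/
theorem IsCellLift.exists_common_vertex (W : BouquetComplex B) (hg : IsImmersion g) {n m : ℕ}
    (hn : n ≤ 2) {c : Cell K n} {x : Cell B n} {ψ : (Fin n → ℝ) → K} (h : IsCellLift g c x ψ)
    {c' : Cell K m} {x' : Cell B m} {ψ' : (Fin m → ℝ) → K} (h' : IsCellLift g c' x' ψ')
    {z : Fin n → ℝ} (hz : z ∈ closedBall 0 1) (hc' : ψ z ∈ openCell c') :
    ∃ q : Vertex W g, (∃ y ∈ closedBall 0 1, q.pt = ψ y) ∧ ∃ y ∈ closedBall 0 1, q.pt = ψ' y := by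
  by_cases hv : IsVertex (ψ z)
  · rw [← h'.image_ball] at hc'
    obtain ⟨y, hy, hyz⟩ := hc'
    exact ⟨⟨_, hv⟩, ⟨z, hz, rfl⟩, y, ball_subset_closedBall hy, hyz.symm⟩
  rcases mem_ball_or_mem_sphere hz with hb | hs
  · have hcc := sigma_eq_of_mem_openCell (h.mem_openCell hb) hc'
    obtain ⟨rfl, hcc⟩ := Sigma.mk.inj_iff.1 hcc
    obtain rfl := eq_of_heq hcc
    have he : EqOn ψ ψ' (closedBall 0 1) := h.eqOn_of_cell hg h'
    -- The two cells coincide, so any vertex on the closed cell will do: an endpoint of a 1-cell,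
    -- the root of a 2-cell.
    have hex : ∃ y ∈ closedBall (0 : Fin n → ℝ) 1, IsVertex (ψ y) := by
      interval_cases n
      · exact absurd ⟨c, h.mem_openCell hb⟩ hv
      · exact ⟨_, sphere_subset_closedBall const_one_mem_sphere,
          isVertex_iff_mem_skel.2 (h.mem_skel hg const_one_mem_sphere)⟩
      · exact ⟨_, sphere_subset_closedBall (W.isBoundaryWalk x).mem_sphere, h.isVertex_root hg⟩
    obtain ⟨y, hy, hyv⟩ := hex
    exact ⟨⟨_, hyv⟩, ⟨y, hy, rfl⟩, y, hy, he hy⟩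
  · have hsk := h.mem_skel hg hs
    interval_cases n
    · exact absurd (isVertex_iff_mem_skel.2 (skel_mono zero_le_one hsk)) hv
    · exact absurd (isVertex_iff_mem_skel.2 hsk) hv
    · by_cases hbl : W.bl x = []
      · rw [h.eq_of_mem_sphere hg hbl hs (W.isBoundaryWalk x).mem_sphere] at hv
        exact absurd (h.isVertex_root hg) hv
      · obtain ⟨q, e, x₁, φ, z₀, z₁, w, -, hφ, h0, h1, hw, hq, hq', hz1⟩ :=
          h.exists_edge_of_mem_sphere (W := W) hg hbl (p := ⟨_, h.isVertex_root hg⟩) rfl hs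
        refine ⟨q, ⟨w, sphere_subset_closedBall hw, hq⟩, ?_⟩
        -- The point is not a vertex, so it is interior to the boundary edge, which must then be the
        -- cell `c'`; the initial vertex `q` of the edge is common to both.
        rcases mem_ball_or_mem_sphere h1 with hb | hs1
        · rw [hz1] at hc'
          have hcc := sigma_eq_of_mem_openCell (hφ.mem_openCell hb) hc'
          obtain ⟨rfl, hcc⟩ := Sigma.mk.inj_iff.1 hcc
          obtain rfl := eq_of_heq hcc
          exact ⟨z₀, h0, hq'.trans (hφ.eqOn_of_cell hg h' h0)⟩
        · exact absurd (isVertex_iff_mem_skel.2 (hz1 ▸ hφ.mem_skel hg hs1)) hv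

/-- A set that contains each closed cell that it meets is closed. -/
theorem isClosed_of_closedCell_subset {S : Set K}
    (h : ∀ n (c : Cell K n), (RelCWComplex.closedCell n c ∩ S).Nonempty →
      RelCWComplex.closedCell n c ⊆ S) : IsClosed S := by
  rw [CWComplex.closed (univ : Set K) S (subset_univ S)]
  intro n c
  rcases (RelCWComplex.closedCell n c ∩ S).eq_empty_or_nonempty with he | hne
  · rw [inter_comm, he]
    exact isClosed_empty
  · rw [inter_eq_self_of_subset_right (h n c hne)]
    exact RelCWComplex.isClosed_closedCell

/-- The graph of a labeled 2-complex is connected. -/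
theorem IsTwoComplex.nonempty_path (hK : IsTwoComplex K) (hg : IsImmersion g) (p q : Vertex W g) :
    Nonempty (Quiver.Path p q) := by
  have hdim : ∀ n (c : Cell K n), n ≤ 2 := fun n c => by
    by_contra hcon
    exact (hK.dim_le_two n (not_le.1 hcon)).false c
  -- `S` is the union of the open cells having a vertex in their closure that can be reached from
  -- `p`. By `key`, a closed cell that meets `S` lies in `S`, so both `S` and its complement are
  -- closed.
  set S : Set K := {y | ∃ (n : ℕ) (c : Cell K n) (x : Cell B n) (ψ : _), IsCellLift g c x ψ ∧
    y ∈ openCell c ∧ ∃ r : Vertex W g, (∃ z ∈ closedBall 0 1, r.pt = ψ z) ∧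
      Nonempty (Quiver.Path p r)} with hS
  have key : ∀ n (c : Cell K n) y, y ∈ (RelCWComplex.closedCell n c : Set K) →
      ∀ y' ∈ (RelCWComplex.closedCell n c : Set K), y ∈ S → y' ∈ S := by
    rintro n c y hy y' hy' ⟨m, d, x, ψ, hψ, hyd, r, ⟨z, hz, hr⟩, ⟨a⟩⟩
    obtain ⟨φ, hφ⟩ := hg.exists_isCellLift c
    rw [← hφ.image_closedBall] at hy hy'
    obtain ⟨w, hw, rfl⟩ := hy
    obtain ⟨w', hw', rfl⟩ := hy'
    obtain ⟨r₁, ⟨z₁, hz₁, hr₁⟩, z₂, hz₂, hr₂⟩ :=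
      hφ.exists_common_vertex W hg (hdim n c) hψ hw hyd
    obtain ⟨k, d', hd'⟩ := exists_mem_openCell (φ w')
    obtain ⟨ψ', hψ'⟩ := hg.exists_isCellLift d'
    obtain ⟨r₂, ⟨z₃, hz₃, hr₃⟩, z₄, hz₄, hr₄⟩ :=
      hφ.exists_common_vertex W hg (hdim n c) hψ' hw' hd'
    obtain ⟨b⟩ := hψ.nonempty_path hg (hdim m d) hz hz₂ hr hr₂
    obtain ⟨b'⟩ := hφ.nonempty_path hg (hdim n c) hz₁ hz₃ hr₁ hr₃
    exact ⟨k, d', _, ψ', hψ', hd', r₂, ⟨z₄, hz₄, hr₄⟩, ⟨(a.comp b).comp b'⟩⟩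
  have hclopen : IsClopen S := by
    constructor
    · refine isClosed_of_closedCell_subset ?_
      rintro n c ⟨y, hy, hyS⟩ y' hy'
      exact key n c y hy y' hy' hyS
    · rw [← isClosed_compl_iff]
      refine isClosed_of_closedCell_subset ?_
      rintro n c ⟨y, hy, hyS⟩ y' hy' hcon
      exact hyS (key n c y' hy' y hy hcon)
  have hpS : p.pt ∈ S := by
    obtain ⟨c, hc⟩ := p.isVertex
    obtain ⟨ψ, hψ⟩ := hg.exists_isCellLift c
    have hc' := hc
    rw [← hψ.image_ball] at hc'
    obtain ⟨z, hz, hzp⟩ := hc'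
    exact ⟨0, c, _, ψ, hψ, hc, p, ⟨z, ball_subset_closedBall hz, hzp.symm⟩, ⟨.nil⟩⟩
  have := hK.connected
  have hqS : q.pt ∈ S := by
    rw [hclopen.eq_univ ⟨_, hpS⟩]
    trivial
  obtain ⟨n, c, x, ψ, hψ, hqc, r, ⟨z, hz, hr⟩, ⟨a⟩⟩ := hqS
  rw [← hψ.image_ball] at hqc
  obtain ⟨z', hz', hq⟩ := hqc
  obtain ⟨b⟩ := hψ.nonempty_path hg (hdim n c) hz (ball_subset_closedBall hz') hr hq.symm
  exact ⟨a.comp b⟩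

end Connectivity

/-! ### Lifting cells from `L` to `K` -/

section CellLifting

variable {B : Type w} [TopologicalSpace B] [T2Space B] [CWComplex (univ : Set B)]
variable {K : Type u} [TopologicalSpace K] [T2Space K] [CWComplex (univ : Set K)]
variable {L : Type v} [TopologicalSpace L] [T2Space L] [CWComplex (univ : Set L)]
variable {W : BouquetComplex B} {gK : K → B} {gL : L → B} {f : K → L}

/-- The characteristic maps of the cells of `L` lift to `K`, from any point over any point of the
closed disk. -/
def HasCellLifts (gK : K → B) (gL : L → B) (f : K → L) : Prop :=
  ∀ (n : ℕ) (d : Cell L n) (x : Cell B n) (φ : (Fin n → ℝ) → L), IsCellLift gL d x φ →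
    ∀ w ∈ closedBall (0 : Fin n → ℝ) 1, ∀ y : K, f y = φ w →
      ∃ (c : Cell K n) (ψ : (Fin n → ℝ) → K), IsCellLift gK c x ψ ∧ ψ w = y

/-- A covering lifts maps from simply connected spaces, and a lift lying over a characteristic map
of `B` is itself the characteristic map of a cell. -/
theorem hasCellLifts_of_isCoveringMap (hK : IsImmersion gK) (hlab : gL ∘ f = gK)
    (hcov : IsCoveringMap f) : HasCellLifts gK gL f := by
  intro n d x φ hφ w hw y hy
  -- Coordinatewise retraction of `ℝⁿ` onto the cube, so that the lifting theorem is applied to a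
  -- map on all of `ℝⁿ`.
  set clamp : (Fin n → ℝ) → (Fin n → ℝ) := fun z i => max (-1) (min 1 (z i)) with hclamp
  have hcont : Continuous clamp := by fun_prop
  have hmem : ∀ z, clamp z ∈ closedBall (0 : Fin n → ℝ) 1 := by
    intro z
    rw [mem_closedBall_zero_iff, pi_norm_le_iff_of_nonneg zero_le_one]
    intro i
    rw [Real.norm_eq_abs, abs_le]
    exact ⟨le_max_left _ _, max_le (by norm_num) (min_le_left _ _)⟩
  have hid : ∀ z ∈ closedBall (0 : Fin n → ℝ) 1, clamp z = z := by
    intro z hz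
    rw [mem_closedBall_zero_iff, pi_norm_le_iff_of_nonneg zero_le_one] at hz
    funext i
    have := hz i
    rw [Real.norm_eq_abs, abs_le] at this
    simp only [hclamp]
    rw [min_eq_right this.2, max_eq_right this.1]
  have hΦ : Continuous (φ ∘ clamp) := hφ.continuousOn.comp_continuous hcont hmem
  obtain ⟨F, ⟨hF1, hF2⟩, -⟩ := hcov.existsUnique_continuousMap_lifts ⟨φ ∘ clamp, hΦ⟩ w y
    (by simp [hid w hw, hy])
  have hF : ∀ z ∈ closedBall (0 : Fin n → ℝ) 1, f (F z) = φ z := by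
    intro z hz
    have := congrFun hF2 z
    simpa [hid z hz] using this
  obtain ⟨c, hc⟩ := hK.exists_isCellLift_of_comp_eq (x := x) (ψ := F) F.continuous.continuousOn
    (fun z hz => by rw [← hφ.comp_eq z hz, ← hF z hz, ← hlab]; rfl)
  exact ⟨c, F, hc, hF1⟩

theorem HasCellLifts.isStarSurjective (h : HasCellLifts gK gL f) (hK : IsImmersion gK) :
    IsStarSurjective W gK gL f := by
  intro p s t e' hs
  cases e' with
  | pos d x hd =>
    obtain ⟨φ, hφ, h0, h1⟩ := hd
    obtain ⟨c, ψ, hψ, hp⟩ := h 1 d x φ hφ _ (sphere_subset_closedBall const_neg_one_mem_sphere) p.pt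
      (hs.symm.trans h0.symm)
    obtain ⟨q, hq⟩ := hψ.exists_vertex (W := W) hK const_one_mem_sphere
    exact ⟨q, .pos c x ⟨ψ, hψ, hp, hq.symm⟩, rfl⟩
  | neg d x hd =>
    obtain ⟨φ, hφ, h0, h1⟩ := hd
    obtain ⟨c, ψ, hψ, hp⟩ := h 1 d x φ hφ _ (sphere_subset_closedBall const_one_mem_sphere) p.pt
      (hs.symm.trans h1.symm)
    obtain ⟨q, hq⟩ := hψ.exists_vertex (W := W) hK const_neg_one_mem_sphere
    exact ⟨q, .neg c x ⟨ψ, hψ, hq.symm, hp⟩, rfl⟩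
  | face d ρ hd =>
    obtain ⟨φ, hφ, h0⟩ := hd
    obtain ⟨c, ψ, hψ, hp⟩ := h 2 d ρ φ hφ _
      (sphere_subset_closedBall (W.isBoundaryWalk ρ).mem_sphere) p.pt (hs.symm.trans h0.symm)
    exact ⟨p, .face c ρ ⟨ψ, hψ, hp⟩, rfl⟩

theorem exists_isCellLift_of_label {p q : Vertex W gK} (e : Arrow W gK p q) {x : Cell B 1}
    {b : Bool} (h : e.label = Sum.inl (x, b)) :
    ∃ (c : Cell K 1) (ψ : _), IsCellLift gK c x ψ ∧ ψ (edgeParam b 0) = p.pt := by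
  rw [edgeParam_zero]
  cases e with
  | pos c y hc =>
    simp only [Arrow.label, Sum.inl.injEq, Prod.mk.injEq] at h
    obtain ⟨rfl, rfl⟩ := h
    obtain ⟨ψ, hψ, h0, h1⟩ := hc
    exact ⟨c, ψ, hψ, h0⟩
  | neg c y hc =>
    simp only [Arrow.label, Sum.inl.injEq, Prod.mk.injEq] at h
    obtain ⟨rfl, rfl⟩ := h
    obtain ⟨ψ, hψ, h0, h1⟩ := hc
    exact ⟨c, ψ, hψ, h1⟩
  | face c ρ hc => simp [Arrow.label] at h

theorem exists_isCellLift_of_label_inr {p q : Vertex W gK} (e : Arrow W gK p q) {ρ : Cell B 2}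
    (h : e.label = Sum.inr ρ) :
    ∃ (c : Cell K 2) (ψ : _), IsCellLift gK c ρ ψ ∧ ψ (W.root ρ) = p.pt := by
  obtain ⟨c, ψ, hψ, hp⟩ := isFace_of_arrow_label_inr e h
  exact ⟨c, ψ, hψ, hp⟩

/-- Over interior points the immersion `gK` already gives the lift; star surjectivity is needed only
at the two ends. -/
theorem IsStarSurjective.exists_edge_lift (h : IsStarSurjective W gK gL f) (hK : IsImmersion gK)
    (hL : IsImmersion gL) (hf : IsImmersion f) (hlab : gL ∘ f = gK) {d : Cell L 1} {x : Cell B 1}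
    {φ : (Fin 1 → ℝ) → L} (hφ : IsCellLift gL d x φ) {w : Fin 1 → ℝ} (hw : w ∈ closedBall 0 1)
    {y : K} (hy : f y = φ w) :
    ∃ (c : Cell K 1) (ψ : _), IsCellLift gK c x ψ ∧ ψ w = y := by
  rcases mem_ball_or_mem_sphere hw with hb | hs
  · refine hK.exists_isCellLift_of_mem_ball hb ?_
    rw [← hφ.comp_eq w hw, ← hy, ← hlab]
    rfl
  · have hv : IsVertex y := by
      rw [← hf.isVertex_iff, hy, isVertex_iff_mem_skel]
      exact hφ.mem_skel hL hs
    -- Either end is the start of the edge for one of its two directions.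
    obtain ⟨b, rfl⟩ : ∃ b, w = edgeParam b 0 := by
      rcases eq_const_of_mem_sphere hs with rfl | rfl
      · exact ⟨false, (edgeParam_zero false).symm⟩
      · exact ⟨true, (edgeParam_zero true).symm⟩
    obtain ⟨s, hs⟩ := hφ.exists_vertex (W := W) hL (edgeParam_zero_mem_sphere b)
    obtain ⟨t, ht⟩ := hφ.exists_vertex (W := W) hL (edgeParam_one_mem_sphere b)
    obtain ⟨a, ha⟩ := hφ.exists_arrow b hs ht
    obtain ⟨q, e, he⟩ := h ⟨y, hv⟩ s t a (hs.trans hy.symm)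
    exact exists_isCellLift_of_label e (he.trans ha)

/-- Star surjectivity lifts the 2-cell at its root only. To reach a point `y` over a later letter,
lift that letter's edge through `y`, go back to its start, take the 2-cell lifted there by
induction, and use uniqueness of lifts along the edge to see that its boundary passes through `y`.
-/
theorem IsStarSurjective.exists_face_lift (h : IsStarSurjective W gK gL f) (hK : IsImmersion gK)
    (hL : IsImmersion gL) (hf : IsImmersion f) (hlab : gL ∘ f = gK) {d : Cell L 2} {ρ : Cell B 2}
    {φ : (Fin 2 → ℝ) → L} (hφ : IsCellLift gL d ρ φ) {w : Fin 2 → ℝ} (hw : w ∈ sphere 0 1)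
    {y : K} (hy : f y = φ w) :
    ∃ (c : Cell K 2) (ψ : _), IsCellLift gK c ρ ψ ∧ ψ w = y := by
  have hroot : ∀ y : K, f y = φ (W.root ρ) →
      ∃ (c : Cell K 2) (ψ : _), IsCellLift gK c ρ ψ ∧ ψ (W.root ρ) = y := by
    intro y hy
    have hv := hφ.isVertex_root (W := W) hL
    have hvy : IsVertex y := by
      rw [← hf.isVertex_iff, hy]
      exact hv
    obtain ⟨q, e, he⟩ := h ⟨y, hvy⟩ ⟨_, hv⟩ ⟨_, hv⟩ (.face d ρ ⟨φ, hφ, rfl⟩) hy.symm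
    exact exists_isCellLift_of_label_inr e he
  have hw₀ := (W.isBoundaryWalk ρ).mem_sphere
  by_cases hbl : W.bl ρ = []
  · obtain ⟨c, ψ, hψ, hr⟩ := hroot y (by rw [hy, hφ.eq_of_mem_sphere hL hbl hw hw₀])
    exact ⟨c, ψ, hψ, by rw [← hr, hψ.eq_of_mem_sphere hK hbl hw hw₀]⟩
  obtain ⟨θ, hc, h0, -, hS, hsurj, hwalk⟩ := (W.isBoundaryWalk ρ).exists_param hbl
  have hB : ∀ (i : Fin (W.bl ρ).length), ∀ s ∈ Icc (0 : ℝ) 1,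
      θ ((i : ℕ) + s) ∈ closedBall (0 : Fin 2 → ℝ) 1 := fun i s hs =>
    sphere_subset_closedBall (hS i s hs)
  have step : ∀ i : Fin (W.bl ρ).length,
      (∀ y : K, f y = φ (θ (i : ℕ)) →
        ∃ (c : Cell K 2) (ψ : _), IsCellLift gK c ρ ψ ∧ ψ (θ (i : ℕ)) = y) →
      ∀ s ∈ Icc (0 : ℝ) 1, ∀ y : K, f y = φ (θ ((i : ℕ) + s)) →
        ∃ (c : Cell K 2) (ψ : _), IsCellLift gK c ρ ψ ∧ ψ (θ ((i : ℕ) + s)) = y := by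
    intro i hi s hs y hy
    obtain ⟨e, φ₁, hφ₁, he⟩ := hL.exists_edge_of_path (γ := fun s => φ (θ ((i : ℕ) + s)))
      (a := (W.bl ρ).get i) (hφ.continuousOn.comp (hc i) fun s hs => hB i s hs)
      (fun s hs => by rw [← hwalk i s hs]; exact hφ.comp_eq _ (hB i s hs))
    obtain ⟨c₁, ψ₁, hψ₁, hy₁⟩ := h.exists_edge_lift hK hL hf hlab hφ₁
      (edgeParam_mem_closedBall ((W.bl ρ).get i).2 hs) (y := y) (hy.trans (he s hs))
    have hz0 : (0 : ℝ) ∈ Icc (0 : ℝ) 1 := by simp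
    have hfψ : EqOn (f ∘ ψ₁) φ₁ (closedBall 0 1) := by
      refine (hψ₁.map hf hlab).eqOn hL hφ₁ (edgeParam_mem_closedBall ((W.bl ρ).get i).2 hs) ?_
      exact (congrArg f hy₁).trans (hy.trans (he s hs))
    have hst : f (ψ₁ (edgeParam ((W.bl ρ).get i).2 0)) = φ (θ (i : ℕ)) := by
      have h1 := he 0 hz0
      have h2 := hfψ (edgeParam_mem_closedBall ((W.bl ρ).get i).2 hz0)
      simp only [add_zero] at h1
      rw [h1]
      exact h2
    obtain ⟨c, ψ, hψ, h2⟩ := hi _ hst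
    refine ⟨c, ψ, hψ, ?_⟩
    rw [← hy₁]
    refine hK.eqOn_of_comp_eqOn (φ := fun s => ψ (θ ((i : ℕ) + s)))
      (ψ := fun s => ψ₁ (edgeParam ((W.bl ρ).get i).2 s)) isPreconnected_Icc
      (hψ.continuousOn.comp (hc i) fun s hs => hB i s hs)
      (hψ₁.continuousOn.comp (continuous_edgeParam _).continuousOn
        fun s hs => edgeParam_mem_closedBall _ hs) ?_ hz0 (by simpa using h2) hs
    intro t ht
    rw [hψ.comp_eq _ (hB i t ht), hwalk i t ht, hψ₁.comp_eq _ (edgeParam_mem_closedBall _ ht)]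
    rfl
  -- Induction along the walk from the root: the end of letter `k` is the case `s = 1` of `step`.
  have hvert : ∀ k : ℕ, k < (W.bl ρ).length → ∀ y : K, f y = φ (θ k) →
      ∃ (c : Cell K 2) (ψ : _), IsCellLift gK c ρ ψ ∧ ψ (θ k) = y := by
    intro k
    induction k with
    | zero =>
      intro _
      rw [Nat.cast_zero, h0]
      exact hroot
    | succ k ih =>
      intro hk
      have := step ⟨k, by omega⟩ (ih (by omega)) 1 (by simp)
      simpa using this
  obtain ⟨i, s, hs, rfl⟩ := hsurj w hw
  exact step i (hvert i i.2) s hs y hy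

theorem IsStarSurjective.hasCellLifts (h : IsStarSurjective W gK gL f) (hK : IsImmersion gK)
    (hL : IsImmersion gL) (hf : IsImmersion f) (hlab : gL ∘ f = gK)
    (hdim : ∀ n, 2 < n → IsEmpty (Cell L n)) : HasCellLifts gK gL f := by
  intro n d x φ hφ w hw y hy
  rcases mem_ball_or_mem_sphere hw with hb | hs
  · refine hK.exists_isCellLift_of_mem_ball hb ?_
    rw [← hφ.comp_eq w hw, ← hy, ← hlab]
    rfl
  · have hn : n ≤ 2 := by
      by_contra hcon
      exact (hdim n (not_le.1 hcon)).false d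
    interval_cases n
    -- The unit sphere of `ℝ⁰` is empty.
    · rw [Subsingleton.elim w 0, mem_sphere_zero_iff_norm, norm_zero] at hs
      exact absurd hs zero_ne_one
    · exact h.exists_edge_lift hK hL hf hlab hφ hw hy
    · exact h.exists_face_lift hK hL hf hlab hφ hs hy

end CellLifting

/-! ### Radial collars -/

section Thickening

variable {K : Type u} [TopologicalSpace K] [T2Space K] [CWComplex (univ : Set K)]
variable {B : Type w} [TopologicalSpace B] [T2Space B] [CWComplex (univ : Set B)]

theorem closedCell_subset_skel {n m : ℕ} (c : Cell K m) (h : m < n) :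
    (RelCWComplex.closedCell m c : Set K) ⊆ skel K n := by
  rw [← RelCWComplex.cellFrontier_union_openCell_eq_closedCell m c]
  rintro y (hy | hy)
  · exact skel_mono h.le (RelCWComplex.cellFrontier_subset_skeletonLT m c hy)
  · exact mem_skel.2 ⟨m, h, c, hy⟩

theorem disjoint_skel_openCell {n m : ℕ} (c : Cell K m) (h : n ≤ m) :
    Disjoint (skel K n) (openCell c) := by
  rw [disjoint_left]
  intro y hy hc
  exact absurd ((mem_skel_iff_of_mem_openCell hc).1 hy) (not_lt.2 h)

/-- An open cell is open in the skeleton of its dimension: its own closed cell loses all but the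
frontier, and the other closed cells of that skeleton miss it. -/
theorem isClosed_skel_diff_openCell {m : ℕ} (c : Cell K m) :
    IsClosed (skel K (m + 1) \ openCell c) := by
  refine CWComplex.isClosed_of_disjoint_openCell_or_isClosed_inter_closedCell
    (C := (univ : Set K)) (subset_univ _) fun k _ c' => ?_
  by_cases hk : m + 1 ≤ k
  · exact Or.inl ((disjoint_skel_openCell c' hk).mono_left sdiff_subset)
  right
  have hsub := closedCell_subset_skel c' (not_le.1 hk)
  by_cases hcc : (⟨k, c'⟩ : Σ n, Cell K n) = ⟨m, c⟩
  · obtain ⟨rfl, hcc⟩ := Sigma.mk.inj_iff.1 hcc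
    obtain rfl := eq_of_heq hcc
    have : (skel K (k + 1) \ openCell c') ∩ (RelCWComplex.closedCell k c' : Set K) =
        RelCWComplex.cellFrontier k c' := by
      ext y
      constructor
      · rintro ⟨⟨-, h1⟩, h2⟩
        rw [← RelCWComplex.cellFrontier_union_openCell_eq_closedCell k c'] at h2
        exact h2.resolve_right h1
      · intro hy
        have hy' := RelCWComplex.cellFrontier_subset_closedCell k c' hy
        refine ⟨⟨hsub hy', fun hcon => ?_⟩, hy'⟩
        exact disjoint_left.1 (disjoint_skel_openCell c' le_rfl)
          (RelCWComplex.cellFrontier_subset_skeletonLT k c' hy) hcon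
    rw [this]
    exact RelCWComplex.isClosed_cellFrontier
  · have : (skel K (m + 1) \ openCell c) ∩ (RelCWComplex.closedCell k c' : Set K) =
        RelCWComplex.closedCell k c' := by
      refine inter_eq_self_of_subset_right fun y hy => ⟨hsub hy, fun hcon => ?_⟩
      rw [← RelCWComplex.cellFrontier_union_openCell_eq_closedCell k c'] at hy
      rcases hy with hy | hy
      · exact disjoint_left.1 (disjoint_skel_openCell c (Nat.lt_succ_iff.1 (not_le.1 hk)))
          (RelCWComplex.cellFrontier_subset_skeletonLT k c' hy) hcon
      · exact hcc (sigma_eq_of_mem_openCell hy hcon)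
    rw [this]
    exact RelCWComplex.isClosed_closedCell

/-- The radial projection of the punctured disk to the boundary. -/
noncomputable def radial {n : ℕ} (z : Fin n → ℝ) : Fin n → ℝ := ‖z‖⁻¹ • z

/-- The bound `1 / 2` serves to keep `z` away from the origin, where the projection breaks down. -/
theorem radial_mem_sphere {n : ℕ} {z : Fin n → ℝ} (hz : 1 / 2 ≤ ‖z‖) :
    radial z ∈ sphere (0 : Fin n → ℝ) 1 := by
  have h : ‖z‖ ≠ 0 := by linarith
  rw [mem_sphere_zero_iff_norm, radial, norm_smul, norm_inv, norm_norm, inv_mul_cancel₀ h]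

theorem radial_of_mem_sphere {n : ℕ} {z : Fin n → ℝ} (hz : z ∈ sphere (0 : Fin n → ℝ) 1) :
    radial z = z := by
  rw [mem_sphere_zero_iff_norm] at hz
  rw [radial, hz, inv_one, one_smul]

theorem continuousOn_radial {n : ℕ} :
    ContinuousOn (radial (n := n)) {z | 1 / 2 ≤ ‖z‖} := by
  refine ContinuousOn.smul (ContinuousOn.inv₀ continuous_norm.continuousOn fun z hz h => ?_)
    continuousOn_id
  have hz' : 1 / 2 ≤ ‖z‖ := hz
  linarith

/-- A set in the `(n-1)`-skeleton together with a radial collar in each `n`-cell. -/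
def thicken (g : K → B) (n : ℕ) (A : Set K) : Set K :=
  A ∪ {y | ∃ (c : Cell K n) (x : Cell B n) (ψ : (Fin n → ℝ) → K), IsCellLift g c x ψ ∧
    ∃ z ∈ ball 0 1, 1 / 2 < ‖z‖ ∧ ψ (radial z) ∈ A ∧ ψ z = y}

variable {g : K → B} {n : ℕ} {A : Set K}

theorem subset_thicken : A ⊆ thicken g n A := subset_union_left

theorem thicken_subset_skel (hA : A ⊆ skel K n) : thicken g n A ⊆ skel K (n + 1) := by
  rintro y (hy | ⟨c, x, ψ, hψ, z, hz, -, -, rfl⟩)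
  · exact skel_mono n.le_succ (hA hy)
  · exact mem_skel.2 ⟨n, n.lt_succ_self, c, hψ.mem_openCell hz⟩

theorem mem_of_mem_thicken {y : K} (hy : y ∈ thicken g n A) (hs : y ∈ skel K n) : y ∈ A := by
  rcases hy with hy | ⟨c, x, ψ, hψ, z, hz, -, -, rfl⟩
  · exact hy
  · exact absurd (hψ.mem_openCell hz) (disjoint_left.1 (disjoint_skel_openCell c le_rfl) hs)

/-- Uniqueness of lifts makes the collar independent of the choice of `ψ` and `z` in the definition,
so it can be tested in any one disk. -/
theorem IsCellLift.mem_thicken_iff (hg : IsImmersion g) (hA : A ⊆ skel K n) {c : Cell K n}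
    {x : Cell B n} {ψ : (Fin n → ℝ) → K} (h : IsCellLift g c x ψ) {z : Fin n → ℝ}
    (hz : z ∈ ball 0 1) : ψ z ∈ thicken g n A ↔ 1 / 2 < ‖z‖ ∧ ψ (radial z) ∈ A := by
  constructor
  · rintro (hy | ⟨c', x', ψ', hψ', z', hz', hn, hr, he⟩)
    · exact absurd (h.mem_openCell hz) (disjoint_left.1 (disjoint_skel_openCell c le_rfl) (hA hy))
    · obtain rfl : c' = c := cell_eq_of_mem_openCell (he ▸ hψ'.mem_openCell hz') (h.mem_openCell hz)
      have heq := hψ'.eqOn_of_cell hg h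
      obtain rfl : z' = z := h.injOn hz' hz ((heq (ball_subset_closedBall hz')).symm.trans he)
      refine ⟨hn, ?_⟩
      rwa [← heq (sphere_subset_closedBall (radial_mem_sphere hn.le))]
  · rintro ⟨hn, hr⟩
    exact Or.inr ⟨c, x, ψ, h, z, hz, hn, hr, rfl⟩

/-- Relative openness survives thickening. Closed cells of dimension below `n` see nothing new and
open cells above `n` are disjoint from the skeleton; in an `n`-cell the question is pulled back to
the disk. -/
theorem isClosed_skel_diff_thicken (hg : IsImmersion g) (hA : A ⊆ skel K n)
    (hc : IsClosed (skel K n \ A)) : IsClosed (skel K (n + 1) \ thicken g n A) := by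
  refine CWComplex.isClosed_of_disjoint_openCell_or_isClosed_inter_closedCell
    (C := (univ : Set K)) (subset_univ _) fun k _ c => ?_
  rcases lt_trichotomy k n with hk | rfl | hk
  · right
    have hsub := closedCell_subset_skel c hk
    have : (skel K (n + 1) \ thicken g n A) ∩ (RelCWComplex.closedCell k c : Set K) =
        (skel K n \ A) ∩ RelCWComplex.closedCell k c := by
      ext y
      constructor
      · rintro ⟨⟨-, h1⟩, h2⟩
        exact ⟨⟨hsub h2, fun h => h1 (subset_thicken h)⟩, h2⟩
      · rintro ⟨⟨h0, h1⟩, h2⟩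
        exact ⟨⟨skel_mono n.le_succ h0, fun h => h1 (mem_of_mem_thicken h h0)⟩, h2⟩
    rw [this]
    exact hc.inter RelCWComplex.isClosed_closedCell
  · right
    obtain ⟨ψ, hψ⟩ := hg.exists_isCellLift c
    refine hψ.isClosed_inter_closedCell ?_
    have hR : IsClosed ({z : Fin k → ℝ | 1 / 2 ≤ ‖z‖} ∩ closedBall 0 1) :=
      (isClosed_le continuous_const continuous_norm).inter isClosed_closedBall
    have hcont : ContinuousOn (fun z => ψ (radial z))
        ({z : Fin k → ℝ | 1 / 2 ≤ ‖z‖} ∩ closedBall 0 1) :=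
      hψ.continuousOn.comp (continuousOn_radial.mono inter_subset_left)
        fun z hz => sphere_subset_closedBall (radial_mem_sphere hz.1)
    -- In the disk the complement of the collar is the half-size ball together with the points whose
    -- radial projection misses `A`; both parts are closed.
    have : closedBall 0 1 ∩ ψ ⁻¹' (skel K (k + 1) \ thicken g k A) = closedBall 0 (1 / 2) ∪
        (({z : Fin k → ℝ | 1 / 2 ≤ ‖z‖} ∩ closedBall 0 1) ∩
          (fun z => ψ (radial z)) ⁻¹' (skel K k \ A)) := by
      ext z
      constructor
      · rintro ⟨hz, hs, ht⟩
        by_cases hn : ‖z‖ ≤ 1 / 2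
        · exact Or.inl (mem_closedBall_zero_iff.2 hn)
        · rw [not_le] at hn
          refine Or.inr ⟨⟨hn.le, hz⟩, hψ.mem_skel hg (radial_mem_sphere hn.le), fun hr => ht ?_⟩
          rcases mem_ball_or_mem_sphere hz with hb | hb
          · exact (hψ.mem_thicken_iff hg hA hb).2 ⟨hn, hr⟩
          · replace hr : ψ (radial z) ∈ A := hr
            rw [radial_of_mem_sphere hb] at hr
            exact subset_thicken hr
      · have hsk : ∀ z ∈ closedBall (0 : Fin k → ℝ) 1, ψ z ∈ skel K (k + 1) := fun z hz =>
          closedCell_subset_skel c k.lt_succ_self (hψ.image_closedBall ▸ mem_image_of_mem ψ hz)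
        rintro (hz | ⟨⟨hn, hz⟩, hs, hr⟩)
        · rw [mem_closedBall_zero_iff] at hz
          have hb : z ∈ ball (0 : Fin k → ℝ) 1 := by
            rw [mem_ball_zero_iff]
            linarith
          refine ⟨ball_subset_closedBall hb, hsk z (ball_subset_closedBall hb), fun ht => ?_⟩
          exact absurd ((hψ.mem_thicken_iff hg hA hb).1 ht).1 (not_lt.2 hz)
        · refine ⟨hz, hsk z hz, fun ht => hr ?_⟩
          rcases mem_ball_or_mem_sphere hz with hb | hb
          · exact ((hψ.mem_thicken_iff hg hA hb).1 ht).2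
          · have := mem_of_mem_thicken ht (hψ.mem_skel hg hb)
            rwa [← radial_of_mem_sphere hb] at this
    rw [this]
    exact isClosed_closedBall.union (hcont.preimage_isClosed_of_isClosed hR hc)
  · exact Or.inl ((disjoint_skel_openCell c hk).mono_left sdiff_subset)

end Thickening

/-! ### Sheets over a neighbourhood, and openness of `f` -/

section Sheets

variable {B : Type w} [TopologicalSpace B] [T2Space B] [CWComplex (univ : Set B)]
variable {K : Type u} [TopologicalSpace K] [T2Space K] [CWComplex (univ : Set K)]
variable {L : Type v} [TopologicalSpace L] [T2Space L] [CWComplex (univ : Set L)]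
variable {gK : K → B} {gL : L → B} {f : K → L}

/-- The sets `A i` are the sheets over the set `V`, which is open in the `(n-1)`-skeleton. -/
structure IsSheeting (f : K → L) (n : ℕ) {ι : Type*} (V : Set L) (A : ι → Set K) : Prop where
  subset_skel : V ⊆ skel L n
  isClosed : IsClosed (skel L n \ V)
  isClosed_sheet : ∀ i, IsClosed (skel K n \ A i)
  bijOn : ∀ i, BijOn f (A i) V
  disjoint : ∀ i j, i ≠ j → Disjoint (A i) (A j)
  cover : f ⁻¹' V ⊆ ⋃ i, A i

theorem isSheeting_openCell (hf : IsImmersion f) {n : ℕ} (d : Cell L n) :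
    IsSheeting f (n + 1) (openCell d)
      (fun c : {c : Cell K n // hf.cellMap c = d} => openCell c.1) where
  subset_skel y hy := mem_skel.2 ⟨n, n.lt_succ_self, d, hy⟩
  isClosed := isClosed_skel_diff_openCell d
  isClosed_sheet c := isClosed_skel_diff_openCell c.1
  bijOn c := by
    have := hf.bijOn c.1
    rwa [c.2] at this
  disjoint c c' h := disjoint_left.2 fun _ hy hy' => h (Subtype.ext (cell_eq_of_mem_openCell hy hy'))
  cover y hy := by
    obtain ⟨c, hc, hcd⟩ := hf.exists_mem_openCell hy
    exact mem_iUnion.2 ⟨⟨c, hcd⟩, hc⟩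

/-- Lifts commute with radial projection, so collar points are governed by their projections, which
lie in the old sheets. Cell lifts are what make each collar surject: a collar in `L` is lifted
starting at the boundary point already present in the sheet. -/
theorem IsSheeting.thicken {n : ℕ} {ι : Type*} {V : Set L} {A : ι → Set K}
    (h : IsSheeting f n V A) (hK : IsImmersion gK) (hL : IsImmersion gL) (hf : IsImmersion f)
    (hlab : gL ∘ f = gK) (hlift : HasCellLifts gK gL f) :
    IsSheeting f (n + 1) (thicken gL n V) (fun i => thicken gK n (A i)) where
  subset_skel := thicken_subset_skel h.subset_skel
  isClosed := isClosed_skel_diff_thicken hL h.subset_skel h.isClosed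
  isClosed_sheet i := isClosed_skel_diff_thicken hK
    (fun _ hy => hf.map_mem_skel_iff.1 (h.subset_skel ((h.bijOn i).mapsTo hy))) (h.isClosed_sheet i)
  bijOn i := by
    have hsk : ∀ y ∈ A i, y ∈ skel K n := fun _ hy =>
      hf.map_mem_skel_iff.1 (h.subset_skel ((h.bijOn i).mapsTo hy))
    refine ⟨?_, ?_, ?_⟩
    · rintro y (hy | ⟨c, x, ψ, hψ, z, hz, hn, hr, rfl⟩)
      · exact Or.inl ((h.bijOn i).mapsTo hy)
      · exact Or.inr ⟨_, x, f ∘ ψ, hψ.map hf hlab, z, hz, hn, (h.bijOn i).mapsTo hr, rfl⟩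
    · intro y hy y' hy' he
      by_cases hys : y ∈ skel K n
      · have hys' : y' ∈ skel K n := by
          rw [← hf.map_mem_skel_iff, ← he, hf.map_mem_skel_iff]
          exact hys
        exact (h.bijOn i).injOn (mem_of_mem_thicken hy hys) (mem_of_mem_thicken hy' hys') he
      · have hys' : y' ∉ skel K n := by
          rw [← hf.map_mem_skel_iff, ← he, hf.map_mem_skel_iff]
          exact hys
        obtain ⟨c, x, ψ, hψ, z, hz, hn, hr, rfl⟩ := hy.resolve_left fun hcon => hys (hsk _ hcon)
        obtain ⟨c', x', ψ', hψ', z', hz', hn', hr', rfl⟩ :=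
          hy'.resolve_left fun hcon => hys' (hsk _ hcon)
        -- Equal images force the same cell of `B` and the same `z`. Then `f ∘ ψ` and `f ∘ ψ'`
        -- agree, so injectivity on `A i` gives equality at the radial projection, and uniqueness of
        -- lifts carries it back to `z`.
        have hx : charMap x z = charMap x' z' := by
          rw [← hψ.comp_eq_of_mem_ball hz, ← hψ'.comp_eq_of_mem_ball hz', ← hlab]
          exact congrArg gL he
        obtain rfl : x = x' :=
          cell_eq_of_mem_openCell (charMap_mem_openCell x hz) (hx ▸ charMap_mem_openCell x' hz')
        obtain rfl := charMap_injOn x hz hz' hx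
        have hrs := sphere_subset_closedBall (radial_mem_sphere hn.le)
        have heq := (hψ.map hf hlab).eqOn hL (hψ'.map hf hlab) (ball_subset_closedBall hz) he
        exact hψ.eqOn hK hψ' hrs ((h.bijOn i).injOn hr hr' (heq hrs)) (ball_subset_closedBall hz)
    · rintro y (hy | ⟨d, x, φ, hφ, z, hz, hn, hr, rfl⟩)
      · obtain ⟨y', hy', rfl⟩ := (h.bijOn i).surjOn hy
        exact ⟨y', subset_thicken hy', rfl⟩
      · obtain ⟨y', hy', he⟩ := (h.bijOn i).surjOn hr
        have hrs := sphere_subset_closedBall (radial_mem_sphere hn.le)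
        obtain ⟨c, ψ, hψ, rfl⟩ := hlift n d x φ hφ _ hrs y' he
        have heq := (hψ.map hf hlab).eqOn hL hφ hrs he
        exact ⟨ψ z, Or.inr ⟨c, x, ψ, hψ, z, hz, hn, hy', rfl⟩, heq (ball_subset_closedBall hz)⟩
  disjoint i j hij := by
    have hsk : ∀ i, ∀ y ∈ A i, y ∈ skel K n := fun i _ hy =>
      hf.map_mem_skel_iff.1 (h.subset_skel ((h.bijOn i).mapsTo hy))
    rw [disjoint_left]
    rintro y (hy | ⟨c, x, ψ, hψ, z, hz, hn, hr, rfl⟩) hy'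
    · exact disjoint_left.1 (h.disjoint i j hij) hy (mem_of_mem_thicken hy' (hsk i y hy))
    · exact disjoint_left.1 (h.disjoint i j hij) hr
        ((hψ.mem_thicken_iff hK (hsk j) hz).1 hy').2
  cover := by
    rintro y (hy | ⟨d, x, φ, hφ, z, hz, hn, hr, he⟩)
    · obtain ⟨i, hi⟩ := mem_iUnion.1 (h.cover hy)
      exact mem_iUnion.2 ⟨i, subset_thicken hi⟩
    · obtain ⟨c, ψ, hψ, rfl⟩ := hK.exists_isCellLift_of_mem_ball (y := y) hz
        (by rw [← hφ.comp_eq_of_mem_ball hz, he, ← hlab]; rfl)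
      have heq := (hψ.map hf hlab).eqOn hL hφ (ball_subset_closedBall hz) he.symm
      have hrs := sphere_subset_closedBall (radial_mem_sphere hn.le)
      have h1 : f (ψ (radial z)) ∈ V := by
        have := heq hrs
        simp only [Function.comp_apply] at this
        rwa [this]
      obtain ⟨i, hi⟩ := mem_iUnion.1 (h.cover h1)
      exact mem_iUnion.2 ⟨i, Or.inr ⟨c, x, ψ, hψ, z, hz, hn, hi, rfl⟩⟩

theorem exists_isSheeting (hK : IsImmersion gK) (hL : IsImmersion gL) (hf : IsImmersion f)
    (hlab : gL ∘ f = gK) (hlift : HasCellLifts gK gL f) {n : ℕ} {d : Cell L n} {y : L}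
    (hy : y ∈ openCell d) (k : ℕ) :
    ∃ (V : Set L) (A : {c : Cell K n // hf.cellMap c = d} → Set K), y ∈ V ∧
      IsSheeting f (n + 1 + k) V A := by
  induction k with
  | zero => exact ⟨_, _, hy, isSheeting_openCell hf d⟩
  | succ k ih =>
    obtain ⟨V, A, hyV, hA⟩ := ih
    exact ⟨_, _, subset_thicken hyV, hA.thicken hK hL hf hlab hlift⟩

/-- Pulled back to the disk of a cell of `L`, the complement of `f '' O` is the intersection, over
all lifts `ψ` of its characteristic map to `K`, of the closed sets where `ψ` avoids `O`; cell lifts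
ensure that these `ψ` reach every point of the fibres. -/
theorem HasCellLifts.isOpenMap (hlift : HasCellLifts gK gL f) (hL : IsImmersion gL)
    (hf : IsImmersion f) (hlab : gL ∘ f = gK) : IsOpenMap f := by
  intro O hO
  rw [← isClosed_compl_iff, CWComplex.closed (univ : Set L) _ (subset_univ _)]
  intro n d
  obtain ⟨φ, hφ⟩ := hL.exists_isCellLift d
  refine hφ.isClosed_inter_closedCell ?_
  have : closedBall 0 1 ∩ φ ⁻¹' (f '' O)ᶜ = closedBall 0 1 ∩
      ⋂ ψ ∈ {ψ : (Fin n → ℝ) → K | (∃ c, IsCellLift gK c (hL.cellMap d) ψ) ∧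
        EqOn (f ∘ ψ) φ (closedBall 0 1)}, closedBall 0 1 ∩ ψ ⁻¹' Oᶜ := by
    ext z
    constructor
    · rintro ⟨hz, hn⟩
      refine ⟨hz, mem_iInter₂.2 fun ψ hψ => ⟨hz, fun hO => hn ⟨ψ z, hO, hψ.2 hz⟩⟩⟩
    · rintro ⟨hz, hn⟩
      refine ⟨hz, ?_⟩
      rintro ⟨y, hy, he⟩
      obtain ⟨c, ψ, hψ, rfl⟩ := hlift n d _ φ hφ z hz y he
      have heq := (hψ.map hf hlab).eqOn hL hφ hz he
      exact (mem_iInter₂.1 hn ψ ⟨⟨c, hψ⟩, heq⟩).2 hy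
  rw [this]
  refine isClosed_closedBall.inter (isClosed_biInter fun ψ hψ => ?_)
  obtain ⟨⟨c, hc⟩, -⟩ := hψ
  exact hc.continuousOn.preimage_isClosed_of_isClosed isClosed_closedBall hO.isClosed_compl

end Sheets

/-! ### Even covering -/

section Covering

/-- An open set whose preimage under an open continuous map is a disjoint union of open sheets is
evenly covered. -/
theorem isEvenlyCovered_of_sheets {K : Type u} {L : Type v} [TopologicalSpace K]
    [TopologicalSpace L] {f : K → L} (hf : Continuous f) (hop : IsOpenMap f) {ι : Type*} {y : L}
    {V : Set L} (hy : y ∈ V) (hV : IsOpen V) {A : ι → Set K} (hA : ∀ i, IsOpen (A i))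
    (hbij : ∀ i, BijOn f (A i) V) (hdisj : ∀ i j, i ≠ j → Disjoint (A i) (A j))
    (hcov : f ⁻¹' V ⊆ ⋃ i, A i) : IsEvenlyCovered f y (f ⁻¹' {y}) := by
  let _ : TopologicalSpace ι := ⊥
  have : DiscreteTopology ι := ⟨rfl⟩
  have hidx : ∀ e : f ⁻¹' V, ∃ i, e.1 ∈ A i := fun e => mem_iUnion.1 (hcov e.2)
  choose idx hidx using hidx
  have huniq : ∀ (e : f ⁻¹' V) i, e.1 ∈ A i → idx e = i := fun e i hi => by
    by_contra hne
    exact disjoint_left.1 (hdisj _ _ hne) (hidx e) hi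
  have hsec : ∀ p : V × ι, ∃ e, e ∈ A p.2 ∧ f e = p.1 := fun p => (hbij p.2).surjOn p.1.2
  choose sec hsecA hsecf using hsec
  have hinv : Continuous idx := by
    rw [continuous_discrete_rng]
    intro i
    have : idx ⁻¹' {i} = Subtype.val ⁻¹' A i := by
      ext e
      exact ⟨fun h => (show idx e = i from h) ▸ hidx e, huniq e i⟩
    rw [this]
    exact (hA i).preimage continuous_subtype_val
  -- On each sheet the section is continuous because `f` is open.
  have hsecc : Continuous sec := by
    rw [continuous_prod_of_discrete_right]
    intro i
    rw [continuous_def]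
    intro O hO
    have : (fun u : V => sec (u, i)) ⁻¹' O = Subtype.val ⁻¹' (f '' (O ∩ A i)) := by
      ext u
      constructor
      · exact fun hu => ⟨sec (u, i), ⟨hu, hsecA (u, i)⟩, hsecf (u, i)⟩
      · rintro ⟨e, ⟨heO, heA⟩, he⟩
        have : sec (u, i) = e := (hbij i).injOn (hsecA (u, i)) heA ((hsecf (u, i)).trans he.symm)
        rwa [mem_preimage, this]
    rw [this]
    exact (hop _ (hO.inter (hA i))).preimage continuous_subtype_val
  have hsecm : ∀ p, sec p ∈ f ⁻¹' V := fun p => by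
    rw [mem_preimage, hsecf]
    exact p.1.2
  have hev : IsEvenlyCovered f y ι := by
    refine ⟨inferInstance, V, hy, hV, hV.preimage hf,
      { toFun := fun e => (⟨f e, e.2⟩, idx e)
        invFun := fun p => ⟨sec p, hsecm p⟩
        left_inv := fun e => Subtype.ext
          ((hbij (idx e)).injOn (hsecA (⟨f e, e.2⟩, idx e)) (hidx e) (hsecf _))
        right_inv := fun p => Prod.ext (Subtype.ext (hsecf p)) (huniq _ _ (hsecA p))
        continuous_toFun := by fun_prop
        continuous_invFun := hsecc.subtype_mk hsecm }, fun e => rfl⟩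
  exact hev.to_isEvenlyCovered_preimage

variable {B : Type w} [TopologicalSpace B] [T2Space B] [CWComplex (univ : Set B)]
variable {K : Type u} [TopologicalSpace K] [T2Space K] [CWComplex (univ : Set K)]
variable {L : Type v} [TopologicalSpace L] [T2Space L] [CWComplex (univ : Set L)]
variable {gK : K → B} {gL : L → B} {f : K → L}

theorem skel_eq_univ {n k : ℕ} (hdim : ∀ m, n < m → IsEmpty (Cell K m)) (hk : n < k) :
    skel K k = univ := by
  refine eq_univ_of_forall fun y => ?_
  obtain ⟨m, c, hc⟩ := exists_mem_openCell y
  refine mem_skel.2 ⟨m, ?_, c, hc⟩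
  by_contra hcon
  exact (hdim m (by omega)).false c

theorem HasCellLifts.isCoveringMap (hlift : HasCellLifts gK gL f) (hK : IsImmersion gK)
    (hL : IsImmersion gL) (hf : IsImmersion f) (hlab : gL ∘ f = gK)
    (hdK : ∀ n, 2 < n → IsEmpty (Cell K n)) (hdL : ∀ n, 2 < n → IsEmpty (Cell L n)) :
    IsCoveringMap f := by
  intro y
  obtain ⟨n, d, hd⟩ := exists_mem_openCell y
  -- Two thickenings suffice for every `n`: the result is open in `skel L (n + 3)`, which is all of
  -- `L` in dimension at most two.
  obtain ⟨V, A, hyV, hA⟩ := exists_isSheeting hK hL hf hlab hlift hd 2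
  have hV := hA.isClosed
  have hAi := hA.isClosed_sheet
  rw [skel_eq_univ hdL (by omega), ← compl_eq_univ_sdiff, isClosed_compl_iff] at hV
  simp only [skel_eq_univ hdK (show 2 < n + 1 + 2 by omega), ← compl_eq_univ_sdiff,
    isClosed_compl_iff] at hAi
  exact isEvenlyCovered_of_sheets hf.continuous (hlift.isOpenMap hL hf hlab) hyV hV hAi hA.bijOn
    hA.disjoint hA.cover

end Covering

end TwoComplexes


/-! ### The main theorem -/

theorem mainTheorem5
    {B : Type w} [TopologicalSpace B] [T2Space B] [CWComplex (Set.univ : Set B)]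
    {C : Type u} [TopologicalSpace C] [T2Space C] [CWComplex (Set.univ : Set C)]
    {D : Type v} [TopologicalSpace D] [T2Space D] [CWComplex (Set.univ : Set D)]
    (W : TwoComplexes.BouquetComplex B) (hC : TwoComplexes.IsTwoComplex C) (hD : TwoComplexes.IsTwoComplex D)
    (gC : C → B) (hgC : TwoComplexes.IsImmersion gC) (gD : D → B) (hgD : TwoComplexes.IsImmersion gD)
    (f : C → D) (hf : TwoComplexes.IsImmersion f) (hlab : gD ∘ f = gC)
    (v : TwoComplexes.Vertex W gC) :
    Function.Injective (TwoComplexes.loopMap (gL := gD) hf hlab v) ∧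
      (IsCoveringMap f ↔
        TwoComplexes.IsFullClosedInverseSubmonoid (MonoidHom.mrange (TwoComplexes.loopMap (gL := gD) hf hlab v))) := by
  refine ⟨TwoComplexes.loopMap_injective hf hlab hgC v, fun hcov => ?_, fun hfull => ?_⟩
  · exact TwoComplexes.isFullClosed_of_isStarSurjective hf hlab hgC hgD
      ((TwoComplexes.hasCellLifts_of_isCoveringMap hgC hlab hcov).isStarSurjective hgC) v
  · have hstar := TwoComplexes.isStarSurjective_of_full hf hlab hgC hgD v
      (fun q => hC.nonempty_path hgC v q) hfull.full
    exact (hstar.hasCellLifts hgC hgD hf hlab hD.dim_le_two).isCoveringMap hgC hgD hf hlab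
      hC.dim_le_two hD.dim_le_two
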